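/- Let $F$ be a field and let $A$ be a central simple $F$-algebra of degree $n$, i.e. a finite-dimensional simple $F$-algebra with center $F$ and $\dim_F A=n^2$. Let $X=\operatorname{SB}(A)$ be the Severi–Brauer variety of $A$: the $F$-scheme whose $R$-points, for every commutative $F$-algebra $R$ and naturally in $R$, are the right ideals of $R\otimes_F A$ that are direct summands of $R\otimes_F A$ as $R$-modules and have constant rank $n$ over $R$ (over a field: the right ideals of dimension $n$, that is, of reduced dimension $1$). Let $\mathcal I\subset \mathcal O_X\otimes_F A$ be the tautological sheaf of right ideals on $X$, i.e. the subsheaf of $\mathcal O_X$-modules whose sections over an affine open $V\subset X$ form the right ideal of $\Gamma(V,\mathcal O_X)\otimes_F A$ that corresponds to the inclusion $V\hookrightarrow X$, and let \[\mathcal T=\mathcal O_X\oplus\mathcal I\oplus\mathcal I^{\otimes 2}\oplus\dots\oplus\mathcal I^{\otimes (n-1)},\] the tensor powers being taken over $\mathcal O_X$. Then the ring $\operatorname{End}_{\mathcal O_X}(\mathcal T)$ of global endomorphisms of $\mathcal T$ has finite global dimension; that is, the supremum of the projective dimensions of all left $\operatorname{End}_{\mathcal O_X}(\mathcal T)$-modules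 is finite. -/

import Mathlib

universe u

open CategoryTheory Limits AlgebraicGeometry Opposite

open scoped TensorProduct

noncomputable section

/-- The (left) global dimension of a ring: the supremum of the projective dimensions of all
left modules. -/
def globalDimension (R : Type u) [Ring R] : WithBot ℕ∞ :=
  ⨆ M : ModuleCat.{u} R, projectiveDimension M

namespace SeveriBrauer

section Points

variable (F : Type u) [Field F] (A : Type u) [Ring A] [Algebra F A] (n : ℕ)

/-- For a central simple `F`-algebra `A` of degree `n` and a commutative `F`-algebra `R`: a right
ideal of `R ⊗[F] A` which is an `R`-direct summand of constant rank `n`. As `A` has dimension `n ^ 2`,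
this says that the quotient is a projective `R`-module of constant rank `n ^ 2 - n`, that is, the
right ideal is a point of Mathlib's Grassmannian of rank `n ^ 2 - n` quotients. If `R` is a field,
these are the right ideals of dimension `n`, i.e. of reduced dimension `1`. -/
structure IdealPoint (R : Type u) [CommRing R] [Algebra F R] extends
    Module.Grassmannian R (R ⊗[F] A) (n ^ 2 - n) where
  mul_mem : ∀ x ∈ toSubmodule, ∀ a : R ⊗[F] A, x * a ∈ toSubmodule

variable {F A n}

lemma IdealPoint.ext_grassmannian {R : Type u} [CommRing R] [Algebra F R]
    {J K : IdealPoint F A n R} (h : J.toGrassmannian = K.toGrassmannian) : J = K := by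
  cases J; cases K; congr 1

lemma mul_mem_map {R S : Type u} [CommRing R] [Algebra F R] [CommRing S] [Algebra F S]
    (f : R →ₐ[F] S) (J : IdealPoint F A n R) :
    ∀ x ∈ (Module.Grassmannian.map f J.toGrassmannian).toSubmodule, ∀ a : S ⊗[F] A,
      x * a ∈ (Module.Grassmannian.map f J.toGrassmannian).toSubmodule := by
  let : Algebra R S := f.toAlgebra
  let : IsScalarTower F R S :=
    IsScalarTower.of_algebraMap_eq' <| IsScalarTower.algebraMap_eq F R S
  rw [Module.Grassmannian.map_toSubmodule]
  intro x hx a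
  induction a using TensorProduct.induction_on with
  | zero => simp
  | add a b ha hb => rw [mul_add]; exact add_mem ha hb
  | tmul s a =>
    have h0 : J.toSubmodule ≤ J.toSubmodule.comap
        (LinearMap.mulRight R ((1 : R) ⊗ₜ[F] a)) := fun y hy => J.mul_mem y hy _
    have key : Module.Grassmannian.baseChangeMkQ S J.toSubmodule ∘ₗ
          LinearMap.mulRight S (s ⊗ₜ[F] a) =
        s • ((J.toSubmodule.mapQ J.toSubmodule _ h0).baseChange S ∘ₗ
          Module.Grassmannian.baseChangeMkQ S J.toSubmodule) := by
      ext b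
      simp [Module.Grassmannian.baseChangeMkQ]
      rw [TensorProduct.smul_tmul', smul_eq_mul, mul_one]
    rw [LinearMap.mem_ker] at hx ⊢
    have := LinearMap.congr_fun key x
    exact this.trans (by simp only [LinearMap.smul_apply, LinearMap.comp_apply]; erw [hx]; simp)

/-- Base change of a right ideal along `R → S`: the image of `S ⊗[R] J` in `S ⊗[F] A`. -/
def IdealPoint.map {R S : Type u} [CommRing R] [Algebra F R] [CommRing S] [Algebra F S]
    (f : R →ₐ[F] S) (J : IdealPoint F A n R) : IdealPoint F A n S where
  toGrassmannian := Module.Grassmannian.map f J.toGrassmannian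
  mul_mem := mul_mem_map f J

variable (F A n) in
/-- The functor of points of the Severi-Brauer variety: it sends a commutative `F`-algebra `R` to
the set of right ideals of `R ⊗[F] A` that are `R`-direct summands of rank `n`. -/
def functor : CommAlgCat.{u} F ⥤ Type u where
  obj R := IdealPoint F A n R
  map f := ↾IdealPoint.map f.hom
  map_id R := by
    refine ConcreteCategory.hom_ext _ _ fun J => ?_
    exact IdealPoint.ext_grassmannian (Module.Grassmannian.map_id _ R J.toGrassmannian)
  map_comp f g := by
    refine ConcreteCategory.hom_ext _ _ fun J => ?_
    exact IdealPoint.ext_grassmannian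
      (Module.Grassmannian.map_comp _ f.hom g.hom J.toGrassmannian)

end Points

section Sheaf

variable {F : Type u} [Field F] (X : Over (Spec (.of F)))

/-- The ring of sections of the structure sheaf of an `F`-scheme, as an `F`-algebra. -/
abbrev sectionsAlgebra (U : X.left.Opens) : Algebra F Γ(X.left, U) :=
  ((Scheme.ΓSpecIso (.of F)).inv ≫ X.hom.appTop ≫
    X.left.presheaf.map (homOfLE (le_top : U ≤ ⊤)).op).hom.toAlgebra

attribute [local instance] sectionsAlgebra

lemma algebraMap_res {U V : X.left.Opens} (h : V ≤ U) (r : F) :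
    X.left.presheaf.map (homOfLE h).op (algebraMap F Γ(X.left, U) r) =
      algebraMap F Γ(X.left, V) r := by
  simp only [RingHom.algebraMap_toAlgebra]
  rw [← CommRingCat.comp_apply, Category.assoc, Category.assoc, ← Functor.map_comp]
  rfl

/-- Restriction of functions, as a homomorphism of `F`-algebras. -/
def res {U V : X.left.Opens} (h : V ≤ U) : Γ(X.left, U) →ₐ[F] Γ(X.left, V) where
  __ := (X.left.presheaf.map (homOfLE h).op).hom
  commutes' r := algebraMap_res X h r

lemma fromSpec_comp_hom {V : X.left.Opens} (hV : IsAffineOpen V) :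
    hV.fromSpec ≫ X.hom = Spec.map (CommRingCat.ofHom (algebraMap F Γ(X.left, V))) := by
  rw [← cancel_mono (Spec (CommRingCat.of F)).toSpecΓ, Category.assoc, Scheme.toSpecΓ_naturality,
    hV.fromSpec_toSpecΓ_assoc]
  simp [RingHom.algebraMap_toAlgebra, Spec.map_comp]
  erw [Category.comp_id]

/-- The inclusion of an affine open subset `V`, as a `Γ(X, V)`-valued point of `X` over `F`. -/
def affinePoint {V : X.left.Opens} (hV : IsAffineOpen V) :
    (algSpec (.of F)).obj (op (CommAlgCat.of F Γ(X.left, V))) ⟶ X :=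
  Over.homMk hV.fromSpec (fromSpec_comp_hom X hV)

/-- The functor of points of an `F`-scheme `X` on commutative `F`-algebras: it sends `R` to the set
of morphisms `Spec R ⟶ X` over `Spec F`. -/
abbrev points : CommAlgCat.{u} F ⥤ Type u :=
  (algSpec (.of F)).rightOp ⋙ yoneda.obj X

variable (A : Type u) [Ring A] [Algebra F A] (n : ℕ)

/-- Restriction of sections of the constant sheaf of algebras `A`. -/
def resTensor {U V : X.left.Opens} (h : V ≤ U) :
    Γ(X.left, U) ⊗[F] A →ₗ[F] Γ(X.left, V) ⊗[F] A :=
  (res X h).toLinearMap.rTensor A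

variable {A} in
@[simp]
lemma resTensor_tmul {U V : X.left.Opens} (h : V ≤ U) (r : Γ(X.left, U)) (a : A) :
    resTensor X A h (r ⊗ₜ[F] a) = X.left.presheaf.map (homOfLE h).op r ⊗ₜ[F] a := rfl

lemma resTensor_id {U : X.left.Opens} (x : Γ(X.left, U) ⊗[F] A) :
    resTensor X A le_rfl x = x := by
  induction x using TensorProduct.induction_on with
  | zero => simp
  | add x y hx hy => rw [map_add, hx, hy]
  | tmul r a => simp

lemma resTensor_resTensor {U V W : X.left.Opens} (h : V ≤ U) (h' : W ≤ V)
    (x : Γ(X.left, U) ⊗[F] A) :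
    resTensor X A h' (resTensor X A h x) = resTensor X A (h'.trans h) x := by
  induction x using TensorProduct.induction_on with
  | zero => simp
  | add x y hx hy => simp only [map_add, hx, hy]
  | tmul r a =>
    simp only [resTensor_tmul]
    rw [← CommRingCat.comp_apply, ← Functor.map_comp]
    rfl

lemma resTensor_smul {U V : X.left.Opens} (h : V ≤ U) (r : Γ(X.left, U))
    (x : Γ(X.left, U) ⊗[F] A) :
    resTensor X A h (r • x) = X.left.presheaf.map (homOfLE h).op r • resTensor X A h x := by
  induction x using TensorProduct.induction_on with
  | zero => simp
  | add x y hx hy => simp only [smul_add, map_add, hx, hy]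
  | tmul s a => simp [TensorProduct.smul_tmul']

/-- The underlying presheaf of abelian groups of `constantModule`. -/
def constantPresheaf : X.left.Opensᵒᵖ ⥤ Ab.{u} where
  obj U := .of (Γ(X.left, U.unop) ⊗[F] A)
  map f := AddCommGrpCat.ofHom (resTensor X A (leOfHom f.unop)).toAddMonoidHom
  map_id U := by
    ext x
    exact resTensor_id X A x
  map_comp f g := by
    ext x
    exact (resTensor_resTensor X A _ _ x).symm

instance (U : X.left.Opensᵒᵖ) :
    Module ((X.left.presheaf ⋙ forget₂ CommRingCat RingCat).obj U)
      ((constantPresheaf X A).obj U) :=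
  inferInstanceAs (Module Γ(X.left, U.unop) (Γ(X.left, U.unop) ⊗[F] A))

/-- The constant sheaf of algebras `A` on `X`, i.e. the `𝒪_X`-module `U ↦ Γ(X, U) ⊗[F] A`. -/
def constantModule : PresheafOfModules.{u} (X.left.presheaf ⋙ forget₂ CommRingCat RingCat) :=
  PresheafOfModules.ofPresheaf (constantPresheaf X A)
    fun _ _ f r m => resTensor_smul X A (leOfHom f.unop) r m

variable {X A n} (e : points X ≅ functor F A n)

/-- For an `F`-scheme `X` representing the Severi-Brauer functor and an affine open subset `V`, the
right ideal of `Γ(X, V) ⊗[F] A` that corresponds to the inclusion of `V` into `X`. -/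
def idealOfAffine {V : X.left.Opens} (hV : IsAffineOpen V) : IdealPoint F A n Γ(X.left, V) :=
  e.hom.app (CommAlgCat.of F Γ(X.left, V)) (affinePoint X hV)

/-- The sections over `U` of the tautological subsheaf of the constant sheaf `A`. -/
def tautologicalSections (U : X.left.Opens) :
    Submodule Γ(X.left, U) (Γ(X.left, U) ⊗[F] A) where
  carrier := {s | ∀ (V : X.left.Opens) (hV : IsAffineOpen V) (h : V ≤ U),
    resTensor X A h s ∈ (idealOfAffine e hV).toSubmodule}
  zero_mem' := fun V hV h => by rw [map_zero]; exact zero_mem _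
  add_mem' := fun {x y} hx hy V hV h => by rw [map_add]; exact add_mem (hx V hV h) (hy V hV h)
  smul_mem' := fun r x hx V hV h => by
    rw [resTensor_smul]; exact Submodule.smul_mem _ _ (hx V hV h)

/-- The tautological subsheaf `I` of the constant sheaf `A` on the Severi-Brauer variety: a section
of `A` belongs to `I` if over every affine open subset it belongs to the right ideal that this
subset parametrizes. -/
def tautologicalSubmodule : (constantModule X A).Submodule where
  obj U := tautologicalSections e U.unop
  map {U U'} f s hs V hV h := by
    have := resTensor_resTensor X A (leOfHom f.unop) h s
    exact this ▸ hs V hV _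

open MonoidalCategory in
/-- The presheaf tensor powers `U ↦ M(U)^{⊗ k}` of a presheaf of modules. -/
def tensorPower {Y : Scheme.{u}}
    (M : PresheafOfModules.{u} (Y.presheaf ⋙ forget₂ CommRingCat RingCat)) :
    ℕ → PresheafOfModules.{u} (Y.presheaf ⋙ forget₂ CommRingCat RingCat)
  | 0 => 𝟙_ _
  | k + 1 => tensorPower M k ⊗ M

/-- The sheaf of modules `I^{⊗ k}`, for the tautological sheaf `I`: the sheaf associated with the
presheaf `U ↦ I(U)^{⊗ k}`. For `k = 0` this is the structure sheaf. -/
def tautologicalPower (k : ℕ) : X.left.Modules :=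
  (PresheafOfModules.sheafification (𝟙 X.left.ringCatSheaf.obj)).obj
    (tensorPower (tautologicalSubmodule e).toPresheafOfModules k)

attribute [local instance] Abelian.hasFiniteBiproducts

/-- The sheaf `T = 𝒪 ⊕ I ⊕ I^{⊗ 2} ⊕ ⋯ ⊕ I^{⊗ (n - 1)}`. -/
def tiltingSheaf : X.left.Modules :=
  ⨁ fun k : Fin n => tautologicalPower e k

end Sheaf

end SeveriBrauer

end

/-!
The endomorphism ring of a finite direct sum `⨁ Tᵢ` with `Hom(Tᵢ, Tⱼ) = 0` for `i < j` and
semisimple `End(Tᵢ)` has finite global dimension: it is triangular for the idempotents `eᵢ` of the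
summands, so a module is covered by projectives `R eᵢ ⊗ eᵢ M`, each of them removing one index from
the support at the cost of one step in the resolution.

For `Tᵢ = I^{⊗ i}` the two hypotheses are verified on points. Over `K = AlgebraicClosure F` the
algebra `A` becomes a matrix algebra, and every right ideal of rank `n` over a local `K`-algebra
consists of the matrices `v wᵀ` for a fixed unimodular vector `v`; the row vector `w` is a
coordinate on `I`. A morphism `I^{⊗ i} ⟶ I^{⊗ j}` thus attaches to each unimodular vector `v` a
matrix `M(v)`, compatibly with base change, and `M(r v) = r ^ (i - j) M(v)` because replacing `v` by
`r v` divides `w` by `r`. On the two charts of a line in projective space `M` is polynomial in `t`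
and in `t⁻¹`, so this homogeneity makes it constant if `i = j` and zero if `i < j`. Right
multiplications by elements of `A` on the factors realize a spanning set of all matrices, so
`K ⊗ End(I^{⊗ i})` is a matrix algebra, and `End(I^{⊗ i})` is semisimple.
-/

/-! ### Triangular rings -/

section Corner

variable {R M ι : Type*} [Ring R] [AddCommGroup M] [Module R M] {e : R}

/-- The `e`-part `e M` of a module `M`, for an idempotent `e`. -/
def cornerPart (e : R) (M : Type*) [AddCommGroup M] [Module R M] : AddSubgroup M where
  carrier := {m | e • m = m}
  zero_mem' := smul_zero e
  add_mem' {a b} (ha : e • a = a) (hb : e • b = b) := by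
    change e • (a + b) = a + b
    rw [smul_add, ha, hb]
  neg_mem' {a} (ha : e • a = a) := by
    change e • (-a) = -a
    rw [smul_neg, ha]

namespace cornerPart

variable (he : IsIdempotentElem e)

lemma mul_coe (d : he.Corner) : e * d.1 = d.1 :=
  ((Subsemigroup.mem_corner_iff he).mp d.2).1

instance module : Module he.Corner (cornerPart e M) where
  smul d w := ⟨d.1 • (w : M), by
    change e • d.1 • (w : M) = d.1 • (w : M)
    rw [← mul_smul, mul_coe]⟩
  one_smul w := Subtype.ext w.2
  mul_smul a b w := Subtype.ext (mul_smul a.1 b.1 (w : M))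
  smul_zero a := Subtype.ext (smul_zero a.1)
  smul_add a x y := Subtype.ext (smul_add a.1 (x : M) y)
  add_smul a b x := Subtype.ext (add_smul a.1 b.1 (x : M))
  zero_smul x := Subtype.ext (zero_smul R (x : M))

lemma coe_smul (d : he.Corner) (w : cornerPart e M) :
    ((d • w : cornerPart e M) : M) = d.1 • (w : M) :=
  rfl

variable (ι) in
/-- The inclusion of the free module `(e R e)^(ι)` into `R^(ι)`. -/
noncomputable def finsuppCoe : (ι →₀ he.Corner) →+ (ι →₀ R) :=
  Finsupp.mapRange.addMonoidHom
    { toFun := Subtype.val, map_zero' := rfl, map_add' := fun _ _ => rfl }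

lemma finsuppCoe_single (i : ι) (d : he.Corner) :
    finsuppCoe ι he (Finsupp.single i d) = Finsupp.single i d.1 :=
  Finsupp.mapRange_single (hf := rfl)

lemma finsuppCoe_smul (d : he.Corner) (x : ι →₀ he.Corner) :
    finsuppCoe ι he (d • x) = d.1 • finsuppCoe ι he x :=
  Finsupp.ext fun _ => rfl

lemma smul_finsuppCoe (x : ι →₀ he.Corner) : e • finsuppCoe ι he x = finsuppCoe ι he x :=
  Finsupp.ext fun i => mul_coe he (x i)

lemma linearCombination_finsuppCoe (v : ι → cornerPart e M) (x : ι →₀ he.Corner) :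
    Finsupp.linearCombination R (fun i => (v i : M)) (finsuppCoe ι he x) =
      Finsupp.linearCombination he.Corner v x := by
  induction x using Finsupp.induction_linear with
  | zero => simp only [map_zero, ZeroMemClass.coe_zero]
  | add x y hx hy => simp only [map_add, hx, hy, AddSubgroup.coe_add]
  | single i d =>
    rw [finsuppCoe_single, Finsupp.linearCombination_single, Finsupp.linearCombination_single,
      coe_smul]

variable {he} (s : cornerPart e M →ₗ[he.Corner] cornerPart e M →₀ he.Corner)

/-- A model of `R e ⊗ e M`, the tensor product being taken over `e R e`, as a submodule of the free
`R`-module on `e M`: it depends on a section `s` of the canonical presentation of `e M`. -/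
noncomputable def extension : Submodule R (cornerPart e M →₀ R) :=
  Submodule.span R (Set.range fun w => finsuppCoe _ he (s w))

lemma exists_smul_eq_of_mem_extension {x : cornerPart e M →₀ R} (hx : x ∈ extension s) :
    ∃ w, e • x = finsuppCoe _ he (s w) := by
  induction hx using Submodule.closure_induction with
  | zero => exact ⟨0, by rw [smul_zero, map_zero, map_zero]⟩
  | add x y _ _ hx hy =>
    obtain ⟨v, hv⟩ := hx
    obtain ⟨w, hw⟩ := hy
    exact ⟨v + w, by rw [smul_add, hv, hw, map_add, map_add]⟩
  | smul_mem r x hx =>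
    obtain ⟨w, rfl⟩ := hx
    let d : he.Corner := ⟨e * r * e, r, rfl⟩
    refine ⟨d • w, ?_⟩
    rw [map_smul, finsuppCoe_smul, mul_smul, smul_finsuppCoe, mul_smul]

lemma smul_eq_zero_of_mem_extension {r : R} (hr : ∀ a, r * a * e = 0) {x : cornerPart e M →₀ R}
    (hx : x ∈ extension s) : r • x = 0 := by
  induction hx using Submodule.closure_induction with
  | zero => exact smul_zero r
  | add x y _ _ hx hy => rw [smul_add, hx, hy, add_zero]
  | smul_mem a x hx =>
    obtain ⟨w, rfl⟩ := hx
    change r • a • finsuppCoe _ he (s w) = 0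
    rw [← smul_finsuppCoe, ← mul_smul, ← mul_smul, hr, zero_smul]

variable {s}

lemma projective_extension (hs : ∀ w, Finsupp.linearCombination he.Corner id (s w) = w) :
    Module.Projective R (extension s) := by
  let g (w : cornerPart e M) : extension s :=
    ⟨finsuppCoe _ he (s w), Submodule.subset_span ⟨w, rfl⟩⟩
  have hg : Submodule.span R (Set.range g) = ⊤ :=
    (Submodule.span_range_subtype_eq_top_iff _ fun w => (g w).2).mpr rfl
  let p : (cornerPart e M →₀ R) →ₗ[R] extension s := Finsupp.linearCombination R g
  have hp (x : cornerPart e M →₀ he.Corner) :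
      (p (finsuppCoe _ he x) : cornerPart e M →₀ R) =
        finsuppCoe _ he (s (Finsupp.linearCombination he.Corner id x)) := by
    induction x using Finsupp.induction_linear with
    | zero => simp only [map_zero, ZeroMemClass.coe_zero]
    | add x y hx hy => simp only [map_add, Submodule.coe_add, hx, hy]
    | single w d =>
      rw [finsuppCoe_single, Finsupp.linearCombination_single, Finsupp.linearCombination_single,
        map_smul, finsuppCoe_smul, Submodule.coe_smul, id]
  exact Module.Projective.of_split (extension s).subtype p <|
    LinearMap.ext_on_range hg fun w => Subtype.ext ((hp (s w)).trans (by rw [hs]; rfl))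

end cornerPart

open cornerPart in
lemma exists_projective_linearMap_of_isSemisimpleRing_corner {R M : Type u} [Ring R]
    [AddCommGroup M] [Module R M] {e : R} (he : IsIdempotentElem e) [IsSemisimpleRing he.Corner] :
    ∃ (P : Type u) (_ : AddCommGroup P) (_ : Module R P) (q : P →ₗ[R] M),
      Module.Projective R P ∧ (∀ m, e • m ∈ q.range) ∧ (∀ x ∈ q.ker, e • x = 0) ∧
      ∀ r, (∀ a, r * a * e = 0) → ∀ x : P, r • x = 0 := by
  obtain ⟨s, hs⟩ := Module.projective_def.mp
    (Module.projective_of_isSemisimpleRing he.Corner (cornerPart e M))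
  let q : (cornerPart e M →₀ R) →ₗ[R] M := Finsupp.linearCombination R Subtype.val
  have hq (w : cornerPart e M) : q (finsuppCoe _ he (s w)) = w :=
    (linearCombination_finsuppCoe he id (s w)).trans (congrArg _ (hs w))
  refine ⟨extension s, inferInstance, inferInstance, q ∘ₗ (extension s).subtype,
    projective_extension hs, fun m => ?_, fun x hx => Subtype.ext ?_, fun r hr x =>
      Subtype.ext (smul_eq_zero_of_mem_extension s hr x.2)⟩
  · let w : cornerPart e M := ⟨e • m, by
      change e • e • m = e • m
      rw [← mul_smul, he.eq]⟩
    exact ⟨⟨finsuppCoe _ he (s w), Submodule.subset_span ⟨w, rfl⟩⟩, hq w⟩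
  · obtain ⟨w, hw⟩ := exists_smul_eq_of_mem_extension s x.2
    have hw0 : (w : M) = 0 := by
      have hx0 : q x.1 = 0 := hx
      rw [← hq, ← hw, map_smul, hx0, smul_zero]
    change e • x.1 = 0
    rw [hw, show w = 0 from Subtype.ext hw0, map_zero, map_zero]

end Corner

section TriangularRings

lemma hasProjectiveDimensionLT_succ_of_linearMap {R P M : Type u} [Ring R] [AddCommGroup P]
    [Module R P] [Module.Projective R P] [AddCommGroup M] [Module R M] (q : P →ₗ[R] M) {k : ℕ}
    (hker : HasProjectiveDimensionLT (ModuleCat.of R q.ker) k)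
    (hcoker : HasProjectiveDimensionLT (ModuleCat.of R (M ⧸ q.range)) (k + 1)) :
    HasProjectiveDimensionLT (ModuleCat.of R M) (k + 1) := by
  have hP : HasProjectiveDimensionLT (ModuleCat.of R P) (k + 1) :=
    hasProjectiveDimensionLT_of_ge _ 1 (k + 1) (by lia)
  have hker' : HasProjectiveDimensionLT (ModuleCat.of R q.rangeRestrict.ker) k := by
    rwa [LinearMap.ker_rangeRestrict]
  have hrange : HasProjectiveDimensionLT (ModuleCat.of R q.range) (k + 1) :=
    (LinearMap.shortExact_shortComplexKer q.surjective_rangeRestrict).hasProjectiveDimensionLT_X₃ k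
      hker' hP
  let S : ShortComplex (ModuleCat.{u} R) := ShortComplex.mk
    (ModuleCat.ofHom q.range.subtype) (ModuleCat.ofHom q.range.mkQ)
    (ModuleCat.hom_ext (LinearMap.exact_subtype_mkQ _).linearMap_comp_eq_zero)
  have hS : S.ShortExact := ModuleCat.shortComplex_shortExact S
    (LinearMap.exact_subtype_mkQ _) (Submodule.injective_subtype _) (Submodule.mkQ_surjective _)
  exact hS.hasProjectiveDimensionLT_X₂ (k + 1) hrange hcoker

variable {R : Type u} [Ring R] {n : ℕ} {e : Fin n → R}

lemma hasProjectiveDimensionLT_of_triangular (he : CompleteOrthogonalIdempotents e)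
    (htri : ∀ i j, i < j → ∀ a, e j * a * e i = 0) [∀ i, IsSemisimpleRing (he.idem i).Corner]
    {k : ℕ} (hk : k ≤ n) (M : ModuleCat.{u} R) (hM : ∀ i : Fin n, k ≤ i → ∀ m : M, e i • m = 0) :
    HasProjectiveDimensionLT M k := by
  induction k generalizing M with
  | zero =>
    have : Subsingleton M := subsingleton_of_forall_eq 0 fun m => by
      rw [← one_smul R m, ← he.complete, Finset.sum_smul]
      exact Finset.sum_eq_zero fun i _ => hM i i.val.zero_le m
    exact (ModuleCat.isZero_of_subsingleton M).hasProjectiveDimensionLT_zero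
  | succ k ih =>
    let l : Fin n := ⟨k, hk⟩
    obtain ⟨P, _, _, q, _, hrange, hker, hsupp⟩ :=
      exists_projective_linearMap_of_isSemisimpleRing_corner (M := M) (he.idem l)
    have eq_or_lt (i : Fin n) (hi : k ≤ i) : i = l ∨ l < i := by
      rw [Fin.ext_iff, Fin.lt_def]
      exact hi.eq_or_lt.imp_left Eq.symm
    have hK : HasProjectiveDimensionLT (ModuleCat.of R q.ker) k := by
      refine ih (by lia) _ fun i hi x => Subtype.ext ?_
      rcases eq_or_lt i hi with rfl | h
      · exact hker _ x.2
      · exact hsupp _ (htri l i h) x.1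
    have hC : HasProjectiveDimensionLT (ModuleCat.of R (M ⧸ q.range)) k := by
      refine ih (by lia) _ fun i hi x => ?_
      obtain ⟨m, rfl⟩ := Submodule.Quotient.mk_surjective _ x
      rw [← Submodule.Quotient.mk_smul, Submodule.Quotient.mk_eq_zero]
      rcases eq_or_lt i hi with rfl | h
      · exact hrange m
      · rw [hM i h]
        exact zero_mem _
    exact hasProjectiveDimensionLT_succ_of_linearMap q hK
      (hasProjectiveDimensionLT_of_ge _ k (k + 1) k.le_succ)

lemma globalDimension_lt_top_of_triangular (he : CompleteOrthogonalIdempotents e)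
    (htri : ∀ i j, i < j → ∀ a, e j * a * e i = 0) [∀ i, IsSemisimpleRing (he.idem i).Corner] :
    globalDimension R < ⊤ := by
  have hle : globalDimension R ≤ (n : ℕ∞) := iSup_le fun M =>
    (projectiveDimension_lt_iff.mpr (hasProjectiveDimensionLT_of_triangular he htri le_rfl M
      fun i hi => absurd i.isLt hi.not_gt)).le
  exact hle.trans_lt (WithBot.coe_lt_coe.mpr (ENat.natCast_lt_top n))

variable {C : Type*} [Category.{u} C]

lemma isIdempotentElem_end_of_retract {X Y : C} (r : Retract X Y) :
    IsIdempotentElem (End.of (r.r ≫ r.i)) := by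
  simp [IsIdempotentElem, End.mul_def, End.of]

variable [Preadditive C]

/-- If `X` is a retract of `Y`, then `End X` is the corner ring of `End Y` at the corresponding
idempotent. -/
def endEquivCornerOfRetract {X Y : C} (r : Retract X Y) :
    End X ≃+* (isIdempotentElem_end_of_retract r).Corner where
  toFun f := ⟨(r.r ≫ f ≫ r.i : Y ⟶ Y), (r.r ≫ f ≫ r.i : Y ⟶ Y), by simp [End.mul_def]⟩
  invFun g := (r.i ≫ g.1 ≫ r.r : X ⟶ X)
  left_inv f := by simp
  right_inv g := Subtype.ext <| by
    have hg := (Subsemigroup.mem_corner_iff (isIdempotentElem_end_of_retract r)).mp g.2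
    simp only [End.mul_def, End.of, Category.assoc] at hg
    simp [hg.1, hg.2]
  map_mul' f g := Subtype.ext <| by
    change r.r ≫ (g ≫ f) ≫ r.i = (r.r ≫ g ≫ r.i) ≫ r.r ≫ f ≫ r.i
    simp
  map_add' f g := Subtype.ext
    ((congrArg (r.r ≫ ·) (Preadditive.add_comp _ _ _ _ _ _)).trans (Preadditive.comp_add ..))

lemma globalDimension_end_biproduct_lt_top (T : Fin n → C) [HasBiproduct T]
    (htri : ∀ i j, i < j → ∀ f : T i ⟶ T j, f = 0) [∀ i, IsSemisimpleRing (End (T i))] :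
    globalDimension (End (⨁ T)) < ⊤ := by
  let r (i : Fin n) : Retract (T i) (⨁ T) := ⟨biproduct.ι T i, biproduct.π T i, by simp⟩
  have he : CompleteOrthogonalIdempotents (R := End (⨁ T)) fun i => (r i).r ≫ (r i).i :=
    { idem i := isIdempotentElem_end_of_retract (r i)
      ortho i j hij := by simp [r, End.mul_def, biproduct.ι_π_ne_assoc T hij.symm]
      complete := biproduct.total }
  have (i : Fin n) : IsSemisimpleRing (he.idem i).Corner :=
    (endEquivCornerOfRetract (r i)).isSemisimpleRing
  refine globalDimension_lt_top_of_triangular he fun i j hij a => ?_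
  have h0 := htri i j hij ((r i).i ≫ a ≫ (r j).r)
  simp only [End.mul_def, Category.assoc]
  rw [reassoc_of% h0, zero_comp, comp_zero]

end TriangularRings

/-! ### Descent of semisimplicity -/

section CentralSimple

open TensorProduct (equivFinsuppOfBasisLeft)

section CoefficientIdeal

variable {F K A κ : Type*} [CommRing F] [Ring K] [Algebra F K] [Ring A] [Algebra F A]
  [DecidableEq κ] (b : Module.Basis κ F K)

lemma equivFinsuppOfBasisLeft_one_tmul_mul (a : A) (x : K ⊗[F] A) (i : κ) :
    equivFinsuppOfBasisLeft b (1 ⊗ₜ a * x) i = a * equivFinsuppOfBasisLeft b x i := by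
  induction x using TensorProduct.induction_on with
  | zero => simp
  | add x y hx hy => simp only [mul_add, map_add, Finsupp.add_apply, hx, hy]
  | tmul k y => simp

lemma equivFinsuppOfBasisLeft_mul_one_tmul (a : A) (x : K ⊗[F] A) (i : κ) :
    equivFinsuppOfBasisLeft b (x * 1 ⊗ₜ a) i = equivFinsuppOfBasisLeft b x i * a := by
  induction x using TensorProduct.induction_on with
  | zero => simp
  | add x y hx hy => simp only [add_mul, map_add, Finsupp.add_apply, hx, hy]
  | tmul k y => simp

variable (I : TwoSidedIdeal (K ⊗[F] A)) (s : Finset κ) (i : κ)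

/-- The two-sided ideal of `A` formed by the `i`-th coordinates, with respect to a basis of `K`, of
the elements of a two-sided ideal of `K ⊗ A` whose coordinates vanish outside `s`. -/
noncomputable def coefficientIdeal : TwoSidedIdeal A :=
  .mk' {a | ∃ y ∈ I, (equivFinsuppOfBasisLeft b y).support ⊆ s ∧ equivFinsuppOfBasisLeft b y i = a}
    ⟨0, zero_mem I, by simp, by simp⟩
    (by
      rintro _ _ ⟨y, hy, hys, rfl⟩ ⟨z, hz, hzs, rfl⟩
      refine ⟨y + z, add_mem hy hz, ?_, by simp⟩
      rw [map_add]
      exact Finsupp.support_add.trans (Finset.union_subset hys hzs))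
    (by
      rintro _ ⟨y, hy, hys, rfl⟩
      exact ⟨-y, neg_mem hy, by rwa [map_neg, Finsupp.support_neg], by simp⟩)
    (by
      rintro a _ ⟨y, hy, hys, rfl⟩
      refine ⟨1 ⊗ₜ a * y, I.mul_mem_left _ _ hy, fun j hj => hys ?_,
        equivFinsuppOfBasisLeft_one_tmul_mul b a y i⟩
      rw [Finsupp.mem_support_iff, equivFinsuppOfBasisLeft_one_tmul_mul] at hj
      exact Finsupp.mem_support_iff.mpr (right_ne_zero_of_mul hj))
    (by
      rintro _ a ⟨y, hy, hys, rfl⟩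
      refine ⟨y * 1 ⊗ₜ a, I.mul_mem_right _ _ hy, fun j hj => hys ?_,
        equivFinsuppOfBasisLeft_mul_one_tmul b a y i⟩
      rw [Finsupp.mem_support_iff, equivFinsuppOfBasisLeft_mul_one_tmul] at hj
      exact Finsupp.mem_support_iff.mpr (left_ne_zero_of_mul hj))

variable {I s i}

lemma mem_coefficientIdeal {a : A} :
    a ∈ coefficientIdeal b I s i ↔ ∃ y ∈ I,
      (equivFinsuppOfBasisLeft b y).support ⊆ s ∧ equivFinsuppOfBasisLeft b y i = a :=
  TwoSidedIdeal.mem_mk' ..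

end CoefficientIdeal

lemma exists_ne_zero_mem_forall_commute {F K A : Type*} [CommRing F] [Ring K] [Algebra F K]
    [Module.Free F K] [Ring A] [Algebra F A] [IsSimpleRing A] {I : TwoSidedIdeal (K ⊗[F] A)}
    (hI : I ≠ ⊥) : ∃ y ∈ I, y ≠ 0 ∧ ∀ a : A, Commute (1 ⊗ₜ a) y := by
  classical
  let b := Module.Free.chooseBasis F K
  let c := equivFinsuppOfBasisLeft (N := A) b
  obtain ⟨x, ⟨hxI, hx0⟩, hmin⟩ := exists_minimalFor_of_wellFoundedLT
    (fun x => x ∈ I ∧ x ≠ 0) (fun x => (c x).support.card) <| by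
      by_contra! h
      exact hI (eq_bot_iff.mpr fun x hx => h x hx)
  obtain ⟨i, hi⟩ : ∃ i, c x i ≠ 0 := by
    by_contra! h
    exact hx0 (c.map_eq_zero_iff.mp (Finsupp.ext h))
  obtain ⟨y, hyI, hys, hyi⟩ := (mem_coefficientIdeal b).mp <| IsSimpleRing.one_mem_of_ne_zero_mem
    (coefficientIdeal b I (c x).support i) hi <|
      (mem_coefficientIdeal b).mpr ⟨x, hxI, subset_rfl, rfl⟩
  refine ⟨y, hyI, fun h => one_ne_zero (α := A) (by simp [← hyi, h]), fun a => ?_⟩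
  -- The commutator lies in `I`, and its `i`-th coordinate vanishes since that of `y` is `1`.
  by_contra h
  have hle := hmin ⟨sub_mem (I.mul_mem_left (1 ⊗ₜ a) y hyI) (I.mul_mem_right y (1 ⊗ₜ a) hyI),
    sub_ne_zero.mpr h⟩
  have hlt : (c (1 ⊗ₜ a * y - y * 1 ⊗ₜ a)).support ⊂ (c x).support := by
    refine (Finset.ssubset_iff_of_subset fun j hj => hys ?_).mpr
      ⟨i, Finsupp.mem_support_iff.mpr hi, ?_⟩
    · rw [Finsupp.mem_support_iff] at hj ⊢
      refine fun h0 => hj ?_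
      rw [map_sub, Finsupp.sub_apply, equivFinsuppOfBasisLeft_one_tmul_mul,
        equivFinsuppOfBasisLeft_mul_one_tmul, h0, mul_zero, zero_mul, sub_zero]
    · rw [Finsupp.notMem_support_iff, map_sub, Finsupp.sub_apply,
        equivFinsuppOfBasisLeft_one_tmul_mul, equivFinsuppOfBasisLeft_mul_one_tmul, hyi, mul_one,
        one_mul, sub_self]
  exact (Finset.card_lt_card hlt).not_ge (hle (Finset.card_lt_card hlt).le)

lemma exists_eq_tmul_one_of_forall_commute {F K A : Type*} [CommRing F] [Ring K] [Algebra F K]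
    [Module.Free F K] [Ring A] [Algebra F A] [Algebra.IsCentral F A] {y : K ⊗[F] A}
    (hy : ∀ a : A, Commute (1 ⊗ₜ a) y) : ∃ k : K, y = k ⊗ₜ 1 := by
  have hmem : y ∈ Subalgebra.centralizer F
      (Algebra.TensorProduct.includeRight : A →ₐ[F] K ⊗[F] A).range := by
    rintro _ ⟨a, rfl⟩
    exact hy a
  rw [Subalgebra.centralizer_range_includeRight_eq_center_tensorProduct] at hmem
  obtain ⟨z, rfl⟩ := hmem
  clear hy
  induction z using TensorProduct.induction_on with
  | zero => exact ⟨0, by simp⟩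
  | tmul k a =>
    obtain ⟨r, hr⟩ := Algebra.mem_bot.mp (Algebra.IsCentral.out a.2)
    refine ⟨r • k, ?_⟩
    simp [← hr, Algebra.algebraMap_eq_smul_one, TensorProduct.smul_tmul']
  | add y z hy hz =>
    obtain ⟨k, hk⟩ := hy
    obtain ⟨l, hl⟩ := hz
    exact ⟨k + l, by rw [map_add, hk, hl, TensorProduct.add_tmul]⟩

instance isSimpleRing_tensorProduct {F K A : Type*} [CommRing F] [DivisionRing K] [Algebra F K]
    [Module.Free F K] [Ring A] [Algebra F A] [Algebra.IsCentral F A] [IsSimpleRing A] :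
    IsSimpleRing (K ⊗[F] A) := by
  have : Nontrivial (K ⊗[F] A) := Module.FaithfullyFlat.lTensor_nontrivial F K A
  refine ⟨⟨fun I => or_iff_not_imp_left.mpr fun hI => ?_⟩⟩
  obtain ⟨y, hyI, hy0, hy⟩ := exists_ne_zero_mem_forall_commute hI
  obtain ⟨k, rfl⟩ := exists_eq_tmul_one_of_forall_commute hy
  have hk : k ≠ 0 := by
    rintro rfl
    exact hy0 (TensorProduct.zero_tmul _ _)
  have h := I.mul_mem_left (k⁻¹ ⊗ₜ (1 : A)) _ hyI
  rw [Algebra.TensorProduct.tmul_mul_tmul, inv_mul_cancel₀ hk, one_mul] at h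
  exact I.one_mem_iff.mp h

lemma exists_algEquiv_matrix_of_isAlgClosed (F K A : Type*) [Field F] [Field K] [Algebra F K]
    [IsAlgClosed K] [Ring A] [Algebra F A] [FiniteDimensional F A] [Algebra.IsCentral F A]
    [IsSimpleRing A] {n : ℕ} (hn : Module.finrank F A = n ^ 2) :
    Nonempty (K ⊗[F] A ≃ₐ[K] Matrix (Fin n) (Fin n) K) := by
  obtain ⟨m, _, ⟨θ⟩⟩ := IsSimpleRing.exists_algEquiv_matrix_of_isAlgClosed K (K ⊗[F] A)
  have h := θ.toLinearEquiv.finrank_eq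
  simp only [Module.finrank_baseChange, hn, Module.finrank_matrix, Fintype.card_fin,
    Module.finrank_self, mul_one] at h
  obtain rfl : n = m := Nat.pow_left_injective two_ne_zero (h.trans (sq m).symm)
  exact ⟨θ⟩

section Descent

variable (F : Type*) {K E ι : Type*} [Field F] [Field K] [Algebra F K] [Ring E] [Algebra F E]

lemma isSimpleRing_of_isSimpleRing_tensorProduct [IsSimpleRing (K ⊗[F] E)] : IsSimpleRing E := by
  have hE : Nontrivial E := by
    by_contra h
    rw [not_nontrivial_iff_subsingleton] at h
    exact not_subsingleton (K ⊗[F] E) inferInstance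
  refine isSimpleRing_iff_isTwoSided_imp.mpr ⟨hE, fun I hI =>
    or_iff_not_imp_right.mpr fun hne => ?_⟩
  have : Nontrivial (E ⧸ I) := Ideal.Quotient.nontrivial_iff.mpr hne
  let q : K ⊗[F] E →ₐ[K] K ⊗[F] (E ⧸ I) :=
    Algebra.TensorProduct.map (AlgHom.id K K) (Ideal.Quotient.mkₐ F I)
  refine eq_bot_iff.mpr fun x hx => ?_
  refine (Module.FaithfullyFlat.one_tmul_eq_zero_iff F E (A := K) x).mp ?_
  refine q.toRingHom.injective ?_
  simp [q, Ideal.Quotient.eq_zero_iff_mem.mpr hx]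

lemma injective_liftBaseChange_of_basis {κ V : Type*} [AddCommGroup V] [Module F V] [Module K V]
    [IsScalarTower F K V] (b : Module.Basis κ F K) {ρ : E →ₗ[F] V}
    (h : ∀ y : κ →₀ E, y.sum (fun k x => b k • ρ x) = 0 → y = 0) :
    Function.Injective (ρ.liftBaseChange K) := by
  classical
  rw [injective_iff_map_eq_zero]
  intro z hz
  obtain ⟨y, rfl⟩ := (equivFinsuppOfBasisLeft b).symm.surjective z
  rw [TensorProduct.equivFinsuppOfBasisLeft_symm_apply, map_finsuppSum] at hz
  rw [h y hz, map_zero]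

variable {F} in
lemma isSemisimpleRing_of_bijective_liftBaseChange [Fintype ι] [DecidableEq ι] [Nonempty ι]
    (ρ : E →ₐ[F] Matrix ι ι K) (hρ : Function.Bijective (ρ.toLinearMap.liftBaseChange K)) :
    IsSemisimpleRing E := by
  let lift : K ⊗[F] E →ₐ[K] Matrix ι ι K := Algebra.TensorProduct.lift
    (Algebra.ofId K (Matrix ι ι K)) ρ fun k x => Algebra.commute_algebraMap_left k (ρ x)
  have hlift : lift.toLinearMap = ρ.toLinearMap.liftBaseChange K :=
    TensorProduct.AlgebraTensorModule.ext fun k x => (Algebra.smul_def k (ρ x)).symm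
  let Φ : K ⊗[F] E ≃ₐ[K] Matrix ι ι K := AlgEquiv.ofBijective lift
    (by rwa [← AlgHom.coe_toLinearMap, hlift])
  have : IsSimpleRing (K ⊗[F] E) := IsSimpleRing.of_ringEquiv Φ.symm.toRingEquiv inferInstance
  have : Module.Finite K (K ⊗[F] E) := Module.Finite.equiv Φ.symm.toLinearEquiv
  have : Module.Finite F E := Module.Finite.of_finite_tensorProduct_of_faithfullyFlat K
  have := isSimpleRing_of_isSimpleRing_tensorProduct F (K := K) (E := E)
  exact IsSimpleRing.isSemisimpleRing_iff_isArtinianRing.mpr (IsArtinianRing.of_finite F E)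

end Descent

end CentralSimple

/-! ### Base change and right ideals of matrix algebras -/

section SemilinearBaseChange

/-- A semilinear map `M → N` over `σ : B → R` which is universal among semilinear maps from `M` to
`R`-modules, i.e. which identifies `N` with the base change `R ⊗[B] M`. -/
def IsSemilinearBaseChange {B R : Type u} [CommRing B] [CommRing R] {σ : B →+* R}
    {M N : Type u} [AddCommGroup M] [Module B M] [AddCommGroup N] [Module R N]
    (f : M →ₛₗ[σ] N) : Prop :=
  ∀ (Q : Type u) [AddCommGroup Q] [Module R Q] (g : M →ₛₗ[σ] Q),
    ∃! h : N →ₗ[R] Q, ∀ m, h (f m) = g m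

namespace IsSemilinearBaseChange

variable {B R : Type u} [CommRing B] [CommRing R] {σ : B →+* R}
  {M N : Type u} [AddCommGroup M] [Module B M] [AddCommGroup N] [Module R N]
  {M' N' : Type u} [AddCommGroup M'] [Module B M'] [AddCommGroup N'] [Module R N']
  {f : M →ₛₗ[σ] N} {f' : M' →ₛₗ[σ] N'}

lemma hom_ext (hf : IsSemilinearBaseChange f) {Q : Type u} [AddCommGroup Q] [Module R Q]
    {g h : N →ₗ[R] Q} (H : ∀ m, g (f m) = h (f m)) : g = h :=
  (hf Q (h.comp f)).unique H fun _ => rfl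

lemma span_range (hf : IsSemilinearBaseChange f) : Submodule.span R (Set.range f) = ⊤ := by
  have : (Submodule.span R (Set.range f)).mkQ = 0 := hf.hom_ext fun m => by
    simpa using Submodule.subset_span (Set.mem_range_self m)
  rw [← Submodule.ker_mkQ (Submodule.span R (Set.range f)), this, LinearMap.ker_zero]

lemma of_span_range (hs : Submodule.span R (Set.range f) = ⊤)
    (h : ∀ (Q : Type u) [AddCommGroup Q] [Module R Q] (g : M →ₛₗ[σ] Q),
      ∃ h : N →ₗ[R] Q, ∀ m, h (f m) = g m) : IsSemilinearBaseChange f := by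
  intro Q _ _ g
  refine existsUnique_of_exists_of_unique (h Q g) fun h₁ h₂ H₁ H₂ => ?_
  refine LinearMap.ext_on hs ?_
  rintro _ ⟨m, rfl⟩
  rw [H₁, H₂]

lemma span_range_tensorMap (hf : Submodule.span R (Set.range f) = ⊤)
    (hf' : Submodule.span R (Set.range f') = ⊤) :
    Submodule.span R (Set.range (TensorProduct.map f f')) = ⊤ := by
  rw [eq_top_iff, ← TensorProduct.map₂_mk_top_top_eq_top, ← hf, ← hf', Submodule.map₂_span_span]
  refine Submodule.span_mono ?_
  rintro _ ⟨_, ⟨m, rfl⟩, _, ⟨m', rfl⟩, rfl⟩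
  exact ⟨m ⊗ₜ m', rfl⟩

lemma tensorMap (hf : IsSemilinearBaseChange f) (hf' : IsSemilinearBaseChange f') :
    IsSemilinearBaseChange (TensorProduct.map f f') := by
  refine of_span_range (span_range_tensorMap hf.span_range hf'.span_range) fun Q _ _ g => ?_
  choose h hh _ using fun m : M => hf' Q (g.comp (TensorProduct.mk B M M' m))
  let h' : M →ₛₗ[σ] (N' →ₗ[R] Q) :=
    { toFun := h
      map_add' := fun a b => hf'.hom_ext fun m => by
        rw [hh, LinearMap.add_apply, hh, hh]
        simp
      map_smul' := fun r a => hf'.hom_ext fun m => by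
        rw [hh, LinearMap.smul_apply, hh]
        simp }
  obtain ⟨H, hH, -⟩ := hf (N' →ₗ[R] Q) h'
  refine ⟨TensorProduct.lift H, fun m => ?_⟩
  induction m using TensorProduct.induction_on with
  | zero => simp only [map_zero]
  | add a b ha hb => rw [map_add, map_add, ha, hb, map_add]
  | tmul m m' =>
    rw [TensorProduct.map_tmul, TensorProduct.lift.tmul, hH]
    exact hh m m'

lemma comp_linearEquiv (hf : IsSemilinearBaseChange f) (l : N ≃ₗ[R] N') :
    IsSemilinearBaseChange (l.toLinearMap.comp f) := by
  intro Q _ _ g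
  obtain ⟨h, hh, -⟩ := hf Q g
  refine ⟨h.comp l.symm.toLinearMap, fun m => by simp [hh], fun h' H => ?_⟩
  have hcomp : h'.comp l.toLinearMap = h := hf.hom_ext fun m => (H m).trans (hh m).symm
  ext y
  simp [← hcomp]

lemma restrict_of_projection (hf : IsSemilinearBaseChange f) {L : Submodule B M}
    {L' : Submodule R N} {g : L →ₛₗ[σ] L'} (hg : ∀ x, (g x : N) = f x)
    (hL' : L' = Submodule.span R (f '' L)) {p : M →ₗ[B] L} (hp : ∀ x : L, p x = x) :
    IsSemilinearBaseChange g := by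
  refine of_span_range ?_ fun Q _ _ k => ?_
  · apply Submodule.map_injective_of_injective L'.injective_subtype
    have hrange : L'.subtype '' Set.range g = f '' L := by
      rw [← Set.range_comp, Set.image_eq_range]
      exact congrArg Set.range (funext hg)
    rw [Submodule.map_span, hrange, Submodule.map_subtype_top, hL']
  · obtain ⟨h, hh, -⟩ := hf Q (k.comp p)
    refine ⟨h.comp L'.subtype, fun x => ?_⟩
    rw [LinearMap.comp_apply, Submodule.subtype_apply, hg, hh, LinearMap.comp_apply, hp]

lemma comp_linearEquiv_left (hf : IsSemilinearBaseChange f) (l : M' ≃ₗ[B] M) :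
    IsSemilinearBaseChange (f.comp l.toLinearMap) := by
  intro Q _ _ g
  obtain ⟨h, hh, hu⟩ := hf Q (g.comp l.symm.toLinearMap)
  refine ⟨h, fun m => by simp [hh], fun h' H => hu h' fun m => ?_⟩
  simpa using H (l.symm m)

variable (σ) in
lemma ringHom : IsSemilinearBaseChange (σ.toSemilinearMap) := by
  refine of_span_range ?_ fun Q _ _ g => ⟨LinearMap.toSpanSingleton R Q (g 1), fun m => ?_⟩
  · rw [eq_top_iff]
    intro x _
    rw [← mul_one x, ← smul_eq_mul]
    exact Submodule.smul_mem _ _ (Submodule.subset_span ⟨1, map_one σ⟩)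
  · change σ m • g 1 = g m
    rw [← map_smulₛₗ, smul_eq_mul, mul_one]

variable (R M) in
/-- The map `m ↦ 1 ⊗ m` from a module to its base change, as a semilinear map. -/
noncomputable def oneTmul [Algebra B R] : M →ₛₗ[algebraMap B R] R ⊗[B] M where
  __ := (TensorProduct.mk B R M 1).toAddHom
  map_smul' a x := by
    change TensorProduct.mk B R M 1 (a • x) = _
    rw [map_smul, ← algebraMap_smul R a]
    rfl

lemma isSemilinearBaseChange_oneTmul [Algebra B R] :
    IsSemilinearBaseChange (oneTmul R M : M →ₛₗ[algebraMap B R] R ⊗[B] M) := by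
  refine of_span_range ?_ fun Q _ _ g => ?_
  · rw [← Submodule.baseChange_top (R := B) (M := M), Submodule.baseChange_eq_span,
      Submodule.map_top, LinearMap.coe_range]
    rfl
  let : Module B Q := Module.compHom Q (algebraMap B R)
  have : IsScalarTower B R Q := ⟨fun a b c => by
    rw [Algebra.smul_def, mul_smul]
    rfl⟩
  let g' : M →ₗ[B] Q := { toFun := g, map_add' := map_add g, map_smul' := map_smulₛₗ g }
  exact ⟨g'.liftBaseChange R, fun m => (LinearMap.liftBaseChange_tmul ..).trans (one_smul R (g m))⟩

lemma exists_pow_smul_eq_zero (hf : IsSemilinearBaseChange f) (r : B)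
    (hr : letI := σ.toAlgebra; IsLocalization.Away r R) {m : M} (hm : f m = 0) :
    ∃ k : ℕ, r ^ k • m = 0 := by
  let := σ.toAlgebra
  have : IsLocalization (Submonoid.powers r) R := hr
  have : IsLocalizedModule (Submonoid.powers r) (TensorProduct.mk B R M 1) :=
    (isLocalizedModule_iff_isBaseChange _ R _).mpr (TensorProduct.isBaseChange B M R)
  obtain ⟨h, hh, -⟩ := hf _ (oneTmul R M)
  have h0 : TensorProduct.mk B R M 1 m = 0 := by
    rw [← map_zero h, ← hm]
    exact (hh m).symm
  obtain ⟨⟨_, k, rfl⟩, hk⟩ := (IsLocalizedModule.eq_zero_iff (Submonoid.powers r) _).mp h0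
  exact ⟨k, hk⟩

lemma exists_pow_smul_eq (hf : IsSemilinearBaseChange f) (r : B)
    (hr : letI := σ.toAlgebra; IsLocalization.Away r R) (y : N) :
    ∃ (k : ℕ) (m : M), σ r ^ k • y = f m := by
  let := σ.toAlgebra
  have : IsLocalization.Away r R := hr
  have hy : y ∈ Submodule.span R (Set.range f) := by rw [hf.span_range]; trivial
  induction hy using Submodule.span_induction with
  | zero => exact ⟨0, 0, by simp⟩
  | mem a ha =>
    obtain ⟨m, rfl⟩ := ha
    exact ⟨0, m, by simp⟩
  | add a b _ _ ha hb =>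
    obtain ⟨k, m, ha⟩ := ha
    obtain ⟨l, m', hb⟩ := hb
    refine ⟨k + l, r ^ l • m + r ^ k • m', ?_⟩
    rw [map_add, map_smulₛₗ, map_smulₛₗ, map_pow, map_pow, ← ha, ← hb, smul_add, ← mul_smul,
      ← mul_smul, ← pow_add, ← pow_add, add_comm l k]
  | smul a b _ hb =>
    obtain ⟨k, m, hb⟩ := hb
    obtain ⟨l, c, hc⟩ := IsLocalization.Away.surj r a
    refine ⟨l + k, c • m, ?_⟩
    rw [map_smulₛₗ, ← hb]
    change _ = algebraMap B R c • _
    rw [← hc, ← mul_smul, ← mul_smul]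
    congr 1
    change σ r ^ (l + k) * a = a * σ r ^ l * σ r ^ k
    ring

end IsSemilinearBaseChange

end SemilinearBaseChange

section ProjectiveQuotient

variable {R M P : Type*} [Ring R] [AddCommGroup M] [Module R M] [AddCommGroup P] [Module R P]

lemma exists_projection_of_projective_quotient (N : Submodule R M) [Module.Projective R (M ⧸ N)] :
    ∃ p : M →ₗ[R] N, ∀ x : N, p x = x := by
  obtain ⟨s, hs⟩ := Module.projective_lifting_property N.mkQ LinearMap.id N.mkQ_surjective
  have hsplit := (LinearMap.exact_subtype_mkQ N).split_tfae'.out 0 1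
  obtain ⟨-, p, hp⟩ := hsplit.mp ⟨N.injective_subtype, s, hs⟩
  exact ⟨p, LinearMap.congr_fun hp⟩

lemma nonempty_linearEquiv_prod_quotient (N : Submodule R M) [Module.Projective R (M ⧸ N)] :
    Nonempty (M ≃ₗ[R] N × (M ⧸ N)) := by
  obtain ⟨s, hs⟩ := Module.projective_lifting_property N.mkQ LinearMap.id N.mkQ_surjective
  have hsplit := (LinearMap.exact_subtype_mkQ N).split_tfae'.out 0 2
  obtain ⟨e, -⟩ := hsplit.mp ⟨N.injective_subtype, s, hs⟩
  exact ⟨e⟩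

lemma projective_quotient_range_of_leftInverse [Module.Projective R M] {i : P →ₗ[R] M}
    {r : M →ₗ[R] P} (h : ∀ x, r (i x) = x) : Module.Projective R (M ⧸ LinearMap.range i) := by
  have hsplit := (LinearMap.exact_map_mkQ_range i).split_tfae'.out 0 1
  obtain ⟨-, s, hs⟩ := hsplit.mpr ⟨(LinearMap.range i).mkQ_surjective, r, LinearMap.ext h⟩
  exact Module.Projective.of_split s _ hs

end ProjectiveQuotient

section Unimodular

open Matrix

/-- A vector is unimodular if its coordinates generate the unit ideal, i.e. if some linear form
takes the value `1` on it. -/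
abbrev IsUnimodular {ι R : Type*} [Fintype ι] [CommSemiring R] (v : ι → R) : Prop :=
  ∃ c, c ⬝ᵥ v = 1

section Map

variable {ι R S G : Type*} [Fintype ι] [CommSemiring R] [CommSemiring S] [FunLike G R S]
  [RingHomClass G R S]

lemma comp_dotProduct_comp_eq_one {c v : ι → R} (h : c ⬝ᵥ v = 1) (f : G) :
    (f ∘ c) ⬝ᵥ (f ∘ v) = 1 := by
  rw [← map_one f, ← h]
  exact ((f : R →+* S).map_dotProduct c v).symm

lemma IsUnimodular.map {v : ι → R} (h : IsUnimodular v) (f : G) : IsUnimodular (f ∘ v) :=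
  let ⟨c, hc⟩ := h
  ⟨f ∘ c, comp_dotProduct_comp_eq_one hc f⟩

end Map

lemma exists_isUnimodular_eq_span_singleton {ι R : Type*} [Fintype ι] [CommRing R]
    [IsLocalRing R] (N : Submodule R (ι → R)) [Module.Projective R ((ι → R) ⧸ N)]
    (hN : Module.finrank R ((ι → R) ⧸ N) + 1 = Fintype.card ι) :
    ∃ v, IsUnimodular v ∧ N = Submodule.span R {v} := by
  classical
  obtain ⟨p, hp⟩ := exists_projection_of_projective_quotient N
  have : Module.Finite R N := Module.Finite.of_surjective p fun x => ⟨x, hp x⟩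
  have : Module.Projective R N := Module.Projective.of_split N.subtype p (LinearMap.ext hp)
  have : Module.Free R N := Module.free_of_flat_of_isLocalRing
  have : Module.Free R ((ι → R) ⧸ N) := Module.free_of_flat_of_isLocalRing
  have hrank : Module.finrank R N = 1 := by
    have h := (nonempty_linearEquiv_prod_quotient N).some.finrank_eq
    rw [Module.finrank_prod, Module.finrank_fintype_fun_eq_card] at h
    omega
  let b := Module.basisUnique Unit hrank
  refine ⟨b (), ⟨fun i => b.repr (p (Pi.single i 1)) (), ?_⟩, ?_⟩
  · let ℓ : (ι → R) →ₗ[R] R := b.coord () ∘ₗ p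
    have hℓ : ℓ (b ()) = 1 := by simp [ℓ, hp]
    rw [pi_eq_sum_univ' (b () : ι → R), map_sum] at hℓ
    simpa [dotProduct, mul_comm, ℓ] using hℓ
  · have hb := congrArg (Submodule.map N.subtype) b.span_eq
    rwa [Submodule.map_span, ← Set.range_comp, Set.range_unique, Submodule.map_subtype_top,
      eq_comm] at hb

lemma IsUnimodular.exists_isUnit {ι R : Type*} [Fintype ι] [CommRing R] [IsLocalRing R]
    {v : ι → R} (h : IsUnimodular v) : ∃ k, IsUnit (v k) := by
  obtain ⟨c, hc⟩ := h
  by_contra! hv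
  have hmem : c ⬝ᵥ v ∈ IsLocalRing.maximalIdeal R :=
    sum_mem fun k _ => Ideal.mul_mem_left _ _ (hv k)
  rw [hc] at hmem
  exact (Ideal.ne_top_iff_one _).mp (IsLocalRing.maximalIdeal.isMaximal R).ne_top hmem

end Unimodular

section MatrixRightIdeals

open Matrix

lemma exists_mem_iff_forall_col_mem_of_mul_mem {m ι R : Type*} [Fintype ι] [CommSemiring R]
    {J : Submodule R (Matrix m ι R)} (hJ : ∀ x ∈ J, ∀ a : Matrix ι ι R, x * a ∈ J) :
    ∃ N : Submodule R (m → R), ∀ x, x ∈ J ↔ ∀ q, x.col q ∈ N := by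
  classical
  refine ⟨⨅ w, J.comap ((vecMulVecBilin R R).flip w), fun x => ?_⟩
  simp only [Submodule.mem_iInf, Submodule.mem_comap, LinearMap.flip_apply,
    vecMulVecBilin_apply_apply]
  refine ⟨fun hx q w => ?_, fun h => ?_⟩
  · rw [← mulVec_single_one, ← mul_vecMulVec]
    exact hJ x hx _
  · have hx : x = ∑ q, vecMulVec (x.col q) (Pi.single q 1) := by
      ext p q
      simp [Matrix.sum_apply, vecMulVec_apply, Pi.single_apply]
    rw [hx]
    exact Submodule.sum_mem _ fun q _ => h q _

end MatrixRightIdeals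

namespace SeveriBrauer

section IdealPoints

variable {F : Type u} [Field F] {A : Type u} [Ring A] [Algebra F A] {n : ℕ}
  {R S T : Type u} [CommRing R] [Algebra F R] [CommRing S] [Algebra F S] [CommRing T] [Algebra F T]

variable (A) in
/-- The extension of scalars `R ⊗[F] A → S ⊗[F] A` along `f : R → S`. -/
noncomputable def extendTensor (f : R →ₐ[F] S) : R ⊗[F] A →ₛₗ[(f : R →+* S)] S ⊗[F] A where
  toFun := Algebra.TensorProduct.map f (AlgHom.id F A)
  map_add' := map_add _
  map_smul' r x := by
    rw [Algebra.smul_def, map_mul, Algebra.smul_def]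
    simp

@[simp]
lemma extendTensor_tmul (f : R →ₐ[F] S) (r : R) (a : A) :
    extendTensor A f (r ⊗ₜ a) = f r ⊗ₜ a := rfl

lemma extendTensor_comp_apply (f : R →ₐ[F] S) (g : S →ₐ[F] T) (x : R ⊗[F] A) :
    extendTensor A (g.comp f) x = extendTensor A g (extendTensor A f x) :=
  LinearMap.rTensor_comp_apply A g.toLinearMap f.toLinearMap x

lemma extendTensor_mul (f : R →ₐ[F] S) (x y : R ⊗[F] A) :
    extendTensor A f (x * y) = extendTensor A f x * extendTensor A f y :=
  map_mul (Algebra.TensorProduct.map f (AlgHom.id F A)) x y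

open TensorProduct.AlgebraTensorModule in
lemma cancelBaseChange_one_tmul [Algebra R S] [IsScalarTower F R S] (x : R ⊗[F] A) :
    cancelBaseChange F R S S A (1 ⊗ₜ x) = extendTensor A (IsScalarTower.toAlgHom F R S) x := by
  induction x using TensorProduct.induction_on with
  | zero => rw [TensorProduct.tmul_zero, map_zero, map_zero]
  | add x y hx hy => rw [TensorProduct.tmul_add, map_add, hx, hy, map_add]
  | tmul r a => simp [Algebra.smul_def]

lemma isSemilinearBaseChange_extendTensor (f : R →ₐ[F] S) :
    IsSemilinearBaseChange (extendTensor A f) := by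
  let : Algebra R S := f.toAlgebra
  have : IsScalarTower F R S := .of_algebraMap_eq' f.comp_algebraMap.symm
  have hext : extendTensor A f =
      (TensorProduct.AlgebraTensorModule.cancelBaseChange F R S S A).toLinearMap.comp
        (IsSemilinearBaseChange.oneTmul S (R ⊗[F] A)) :=
    LinearMap.ext fun x => (cancelBaseChange_one_tmul x).symm
  rw [hext]
  exact IsSemilinearBaseChange.isSemilinearBaseChange_oneTmul.comp_linearEquiv _

lemma IdealPoint.ext {J J' : IdealPoint F A n R} (h : J.toSubmodule = J'.toSubmodule) : J = J' :=
  IdealPoint.ext_grassmannian (Module.Grassmannian.ext h)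

lemma IdealPoint.map_comp (f : R →ₐ[F] S) (g : S →ₐ[F] T) (J : IdealPoint F A n R) :
    J.map (g.comp f) = (J.map f).map g :=
  IdealPoint.ext_grassmannian (Module.Grassmannian.map_comp _ f g J.toGrassmannian)

lemma IdealPoint.map_toSubmodule (f : R →ₐ[F] S) (J : IdealPoint F A n R) :
    (J.map f).toSubmodule = Submodule.span S (extendTensor A f '' J.toSubmodule) := by
  let : Algebra R S := f.toAlgebra
  have : IsScalarTower F R S := .of_algebraMap_eq' f.comp_algebraMap.symm
  let e := TensorProduct.AlgebraTensorModule.cancelBaseChange F R S S A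
  have hker : LinearMap.ker (J.toSubmodule.mkQ.baseChange S) = J.toSubmodule.baseChange S :=
    LinearMap.exact_iff.mp
      (lTensor_exact S (LinearMap.exact_subtype_mkQ J.toSubmodule) J.toSubmodule.mkQ_surjective)
  calc (J.map f).toSubmodule
    _ = LinearMap.ker (J.toSubmodule.mkQ.baseChange S ∘ₗ e.symm.toLinearMap) :=
      Module.Grassmannian.map_toSubmodule ..
    _ = (J.toSubmodule.baseChange S).map e.toLinearMap := by
      rw [LinearMap.ker_comp, hker]
      exact (Submodule.map_equiv_eq_comap_symm e _).symm
    _ = Submodule.span S (extendTensor A f '' J.toSubmodule) := by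
      rw [Submodule.baseChange_eq_span, Submodule.map_span, Submodule.map_coe, Set.image_image]
      exact congrArg _ (Set.image_congr fun x _ => cancelBaseChange_one_tmul x)

lemma IdealPoint.extendTensor_mem (f : R →ₐ[F] S) (J : IdealPoint F A n R) {x : R ⊗[F] A}
    (hx : x ∈ J.toSubmodule) : extendTensor A f x ∈ (J.map f).toSubmodule := by
  rw [IdealPoint.map_toSubmodule]
  exact Submodule.subset_span ⟨x, hx, rfl⟩

/-- The canonical map from a right ideal to its base change. -/
noncomputable def IdealPoint.toMap (f : R →ₐ[F] S) (J : IdealPoint F A n R)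
    {J' : IdealPoint F A n S} (h : J.map f = J') :
    J.toSubmodule →ₛₗ[(f : R →+* S)] J'.toSubmodule where
  toFun x := ⟨extendTensor A f x, h ▸ J.extendTensor_mem f x.2⟩
  map_add' x y := Subtype.ext (map_add (extendTensor A f) (x : R ⊗[F] A) y)
  map_smul' r x := Subtype.ext (map_smulₛₗ (extendTensor A f) r (x : R ⊗[F] A))

lemma IdealPoint.isSemilinearBaseChange_toMap (f : R →ₐ[F] S) (J : IdealPoint F A n R)
    {J' : IdealPoint F A n S} (h : J.map f = J') :
    IsSemilinearBaseChange (J.toMap f h) := by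
  obtain ⟨p, hp⟩ := exists_projection_of_projective_quotient J.toSubmodule
  exact (isSemilinearBaseChange_extendTensor f).restrict_of_projection (fun _ => rfl)
    (h ▸ J.map_toSubmodule f) hp

end IdealPoints

section Split

open Matrix

variable {F : Type u} [Field F] {A : Type u} [Ring A] [Algebra F A] {n : ℕ}
  {K : Type u} [Field K] [Algebra F K] (θ : K ⊗[F] A ≃ₐ[K] Matrix (Fin n) (Fin n) K)
  (R S : Type u) [CommRing R] [Algebra F R] [Algebra K R] [IsScalarTower F K R]
  [CommRing S] [Algebra F S] [Algebra K S] [IsScalarTower F K S]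

/-- The homomorphism `R ⊗[F] A → Mₙ(R)` induced by a splitting of `A` over `K`. -/
noncomputable def splitHom : R ⊗[F] A →ₐ[R] Matrix (Fin n) (Fin n) R :=
  Algebra.TensorProduct.lift (Algebra.ofId R _)
    (((Algebra.ofId K R).mapMatrix.restrictScalars F).comp
      ((θ.toAlgHom.restrictScalars F).comp Algebra.TensorProduct.includeRight))
    fun _ _ => Algebra.commutes _ _

lemma splitHom_tmul (r : R) (a : A) :
    splitHom θ R (r ⊗ₜ a) = r • (θ (1 ⊗ₜ a)).map (algebraMap K R) := by
  rw [Algebra.smul_def]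
  rfl

lemma splitHom_bijective : Function.Bijective (splitHom θ R) := by
  let e₁ : R ⊗[F] A ≃ₗ[R] R ⊗[K] (K ⊗[F] A) :=
    (TensorProduct.AlgebraTensorModule.cancelBaseChange F K R R A).symm
  let e₂ : R ⊗[K] (K ⊗[F] A) ≃ₐ[K] R ⊗[K] Matrix (Fin n) (Fin n) K :=
    Algebra.TensorProduct.congr AlgEquiv.refl θ
  let e₃ := (matrixEquivTensor (Fin n) K R).symm
  have : ∀ x, splitHom θ R x = e₃ (e₂ (e₁ x)) := by
    intro x
    induction x using TensorProduct.induction_on with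
    | zero => simp
    | add x y hx hy => rw [map_add, hx, hy, map_add, map_add, map_add]
    | tmul r a =>
      rw [splitHom_tmul]
      simp [e₁, e₂, e₃]
  rw [show ⇑(splitHom θ R) = e₃ ∘ e₂ ∘ e₁ from funext this]
  exact e₃.bijective.comp (e₂.bijective.comp e₁.bijective)

/-- The isomorphism `R ⊗[F] A ≃ Mₙ(R)` induced by a splitting of `A` over `K`. -/
noncomputable def splitEquiv : R ⊗[F] A ≃ₐ[R] Matrix (Fin n) (Fin n) R :=
  AlgEquiv.ofBijective (splitHom θ R) (splitHom_bijective θ R)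

lemma splitEquiv_tmul (r : R) (a : A) :
    splitEquiv θ R (r ⊗ₜ a) = r • (θ (1 ⊗ₜ a)).map (algebraMap K R) :=
  splitHom_tmul θ R r a

variable {R S} in
lemma splitEquiv_extendTensor (h : R →ₐ[K] S) (x : R ⊗[F] A) :
    splitEquiv θ S (extendTensor A (h.restrictScalars F) x) = (splitEquiv θ R x).map h := by
  induction x using TensorProduct.induction_on with
  | zero => rw [map_zero, map_zero, map_zero, Matrix.map_zero _ (map_zero h)]
  | add x y hx hy => rw [map_add, map_add, hx, hy, map_add, Matrix.map_add _ (map_add h)]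
  | tmul r a =>
    rw [extendTensor_tmul, splitEquiv_tmul, splitEquiv_tmul]
    ext p q
    simp

variable {R}

/-- The rank one matrices `v wᵀ` with fixed `v`, as a linear map in `w`. -/
noncomputable def splitIdealMap (v : Fin n → R) :
    (Fin n → R) →ₗ[R] R ⊗[F] A :=
  (splitEquiv θ R).symm.toLinearMap ∘ₗ vecMulVecBilin R R v

@[simp]
lemma splitEquiv_splitIdealMap (v w : Fin n → R) :
    splitEquiv θ R (splitIdealMap θ v w) = vecMulVec v w :=
  (splitEquiv θ R).apply_symm_apply _

lemma mem_range_splitIdealMap {v : Fin n → R} {x : R ⊗[F] A} :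
    x ∈ LinearMap.range (splitIdealMap θ v) ↔ ∃ w, splitEquiv θ R x = vecMulVec v w := by
  constructor
  · rintro ⟨w, rfl⟩
    exact ⟨w, splitEquiv_splitIdealMap θ v w⟩
  · rintro ⟨w, hw⟩
    exact ⟨w, (splitEquiv θ R).injective (by rw [splitEquiv_splitIdealMap, hw])⟩

/-- The row vector `cᵀ x`, for `x` seen as a matrix. If `cᵀ v = 1`, it recovers the coordinates `w`
of `x = v wᵀ`. -/
noncomputable def splitCoord (c : Fin n → R) : R ⊗[F] A →ₗ[R] (Fin n → R) where
  toFun x := c ᵥ* splitEquiv θ R x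
  map_add' x y := by rw [map_add, vecMul_add]
  map_smul' r x := by rw [map_smul, vecMul_smul]; rfl

lemma splitCoord_apply (c : Fin n → R) (x : R ⊗[F] A) :
    splitCoord θ c x = c ᵥ* splitEquiv θ R x := rfl

lemma splitCoord_splitIdealMap {c v : Fin n → R} (h : c ⬝ᵥ v = 1) (w : Fin n → R) :
    splitCoord θ c (splitIdealMap θ v w) = w := by
  rw [splitCoord_apply, splitEquiv_splitIdealMap, vecMul_vecMulVec, h]
  simp

lemma projective_quotient_splitIdealMap {v : Fin n → R} (h : IsUnimodular v) :
    Module.Projective R (R ⊗[F] A ⧸ LinearMap.range (splitIdealMap θ v)) :=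
  projective_quotient_range_of_leftInverse (splitCoord_splitIdealMap θ h.choose_spec)

/-- The coordinates identify the right ideal of a unimodular vector with `Rⁿ`. -/
noncomputable def rangeSplitIdealMapEquiv {c v : Fin n → R} (h : c ⬝ᵥ v = 1) :
    LinearMap.range (splitIdealMap θ v) ≃ₗ[R] (Fin n → R) :=
  (LinearEquiv.ofLeftInverse (splitCoord_splitIdealMap θ h)).symm

lemma rankAtStalk_quotient_splitIdealMap [FiniteDimensional F A] {v : Fin n → R}
    (h : IsUnimodular v) (p : PrimeSpectrum R) :
    Module.rankAtStalk (R ⊗[F] A ⧸ LinearMap.range (splitIdealMap θ v)) p = n ^ 2 - n := by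
  have : Nontrivial R := p.nontrivial
  have := projective_quotient_splitIdealMap θ h
  have := Module.Free.of_equiv (rangeSplitIdealMapEquiv θ h.choose_spec).symm
  have := Module.Finite.equiv (rangeSplitIdealMapEquiv θ h.choose_spec).symm
  obtain ⟨e⟩ := nonempty_linearEquiv_prod_quotient (LinearMap.range (splitIdealMap θ v))
  have hrank := congrFun (Module.rankAtStalk_eq_of_equiv e) p
  simp only [Module.rankAtStalk_prod, Module.rankAtStalk_eq_finrank_of_free, Pi.add_apply,
    (rangeSplitIdealMapEquiv θ h.choose_spec).finrank_eq, (splitEquiv θ R).toLinearEquiv.finrank_eq,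
    Module.finrank_matrix, Module.finrank_fintype_fun_eq_card, Fintype.card_fin,
    Module.finrank_self, mul_one, Pi.natCast_apply, Nat.cast_id] at hrank
  rw [sq]
  omega

lemma exists_mem_iff_forall_col_mem (J : IdealPoint F A n R) :
    ∃ N : Submodule R (Fin n → R),
      ∀ x, x ∈ J.toSubmodule ↔ ∀ q, (splitEquiv θ R x).col q ∈ N := by
  let ψ := splitEquiv θ R
  obtain ⟨N, hN⟩ := exists_mem_iff_forall_col_mem_of_mul_mem
    (J := J.toSubmodule.comap ψ.symm.toLinearMap) fun x hx a => by
      simpa [ψ] using J.mul_mem _ hx (ψ.symm a)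
  exact ⟨N, fun x => by simpa [ψ] using hN (ψ x)⟩

lemma nonempty_quotient_linearEquiv_pi {J : IdealPoint F A n R} {N : Submodule R (Fin n → R)}
    (h : ∀ x, x ∈ J.toSubmodule ↔ ∀ q, (splitEquiv θ R x).col q ∈ N) :
    Nonempty ((R ⊗[F] A ⧸ J.toSubmodule) ≃ₗ[R] (Fin n → (Fin n → R) ⧸ N)) := by
  let cols : R ⊗[F] A ≃ₗ[R] (Fin n → Fin n → R) :=
    (splitEquiv θ R).toLinearEquiv ≪≫ₗ transposeLinearEquiv _ _ R R ≪≫ₗ (ofLinearEquiv R).symm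
  refine ⟨Submodule.Quotient.equiv _ (.pi Set.univ fun _ => N) cols ?_ ≪≫ₗ
    Submodule.quotientPi fun _ => N⟩
  ext y
  obtain ⟨x, rfl⟩ := cols.surjective y
  simpa [cols.injective.eq_iff] using show x ∈ J.toSubmodule ↔ ∀ q, cols x q ∈ N from h x

variable [FiniteDimensional F A]

/-- The right ideal of matrices with columns in the line spanned by a unimodular vector `v`. -/
noncomputable def splitPoint (v : Fin n → R) (h : IsUnimodular v) : IdealPoint F A n R where
  toSubmodule := LinearMap.range (splitIdealMap θ v)
  finite_quotient := inferInstance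
  projective_quotient := projective_quotient_splitIdealMap θ h
  rankAtStalk_eq := rankAtStalk_quotient_splitIdealMap θ h
  mul_mem := by
    intro x hx a
    obtain ⟨w, hw⟩ := (mem_range_splitIdealMap θ).mp hx
    refine (mem_range_splitIdealMap θ).mpr ⟨w ᵥ* splitEquiv θ R a, ?_⟩
    rw [map_mul, hw, vecMulVec_mul]

lemma splitPoint_toSubmodule (v : Fin n → R) (h : IsUnimodular v) :
    (splitPoint θ v h).toSubmodule = LinearMap.range (splitIdealMap θ v) := rfl

variable {S} in
lemma splitPoint_map (f : R →ₐ[K] S) (v : Fin n → R) (h : IsUnimodular v) :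
    (splitPoint θ v h).map (f.restrictScalars F) =
      splitPoint θ (f ∘ v) (h.map f) := by
  have key (w : Fin n → R) : extendTensor A (f.restrictScalars F) (splitIdealMap θ v w) =
      splitIdealMap θ (f ∘ v) (f ∘ w) := by
    apply (splitEquiv θ S).injective
    rw [splitEquiv_extendTensor, splitEquiv_splitIdealMap, splitEquiv_splitIdealMap]
    ext p q
    simp [vecMulVec_apply]
  refine IdealPoint.ext ?_
  rw [IdealPoint.map_toSubmodule, splitPoint_toSubmodule, splitPoint_toSubmodule]
  apply le_antisymm
  · rw [Submodule.span_le]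
    rintro _ ⟨_, ⟨w, rfl⟩, rfl⟩
    exact ⟨f ∘ w, (key w).symm⟩
  · rintro _ ⟨w, rfl⟩
    rw [pi_eq_sum_univ' w, map_sum]
    refine Submodule.sum_mem _ fun i _ => ?_
    rw [map_smul]
    refine Submodule.smul_mem _ _ (Submodule.subset_span ⟨_, ⟨Pi.single i 1, rfl⟩, ?_⟩)
    rw [key]
    congr 1
    ext j
    simp [Pi.single_apply, apply_ite f, eq_comm]

lemma splitPoint_smul (v : Fin n → R) (h : IsUnimodular v) (r : Rˣ)
    (h' : IsUnimodular ((r : R) • v)) : splitPoint θ ((r : R) • v) h' = splitPoint θ v h := by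
  refine IdealPoint.ext ?_
  have hsmul : splitIdealMap θ ((r : R) • v) =
      splitIdealMap θ v ∘ₗ (LinearEquiv.smulOfUnit r).toLinearMap := by
    refine LinearMap.ext fun w => (splitEquiv θ R).injective ?_
    simp only [LinearMap.comp_apply, splitEquiv_splitIdealMap, smul_vecMulVec]
    exact (vecMulVec_smul (r : R) v w).symm
  rw [splitPoint_toSubmodule, splitPoint_toSubmodule, hsmul, LinearEquiv.range_comp]

theorem exists_eq_splitPoint [IsLocalRing R] [NeZero n] (J : IdealPoint F A n R) :
    ∃ (v : Fin n → R) (h : IsUnimodular v), J = splitPoint θ v h := by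
  obtain ⟨N, hN⟩ := exists_mem_iff_forall_col_mem θ J
  obtain ⟨e⟩ := nonempty_quotient_linearEquiv_pi θ hN
  have : Module.Projective R (Fin n → (Fin n → R) ⧸ N) := .of_equiv e
  have : Module.Projective R ((Fin n → R) ⧸ N) :=
    .of_split (LinearMap.single R (fun _ : Fin n => (Fin n → R) ⧸ N) 0) (LinearMap.proj 0)
      (LinearMap.proj_comp_single_same ..)
  have : Module.Free R ((Fin n → R) ⧸ N) := Module.free_of_flat_of_isLocalRing
  have hrank : n ^ 2 - n = n * Module.finrank R ((Fin n → R) ⧸ N) := by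
    rw [← J.rankAtStalk_eq (IsLocalRing.closedPoint R), Module.rankAtStalk_eq_of_equiv e,
      Module.rankAtStalk_eq_finrank_of_free, Module.finrank_pi_fintype]
    simp
  obtain ⟨v, hv, rfl⟩ := exists_isUnimodular_eq_span_singleton N (by
    rw [sq, ← Nat.mul_sub_one] at hrank
    have := Nat.eq_of_mul_eq_mul_left (NeZero.pos n) hrank
    have := NeZero.pos n
    rw [Fintype.card_fin]
    omega)
  refine ⟨v, hv, IdealPoint.ext ?_⟩
  ext x
  have hcol (w : Fin n → R) :
      splitEquiv θ R x = vecMulVec v w ↔ ∀ q, w q • v = (splitEquiv θ R x).col q := by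
    refine ⟨fun h q => ?_, fun h => ?_⟩
    · ext p
      simp [h, vecMulVec_apply, mul_comm]
    · ext p q
      simpa [vecMulVec_apply, mul_comm] using (congrFun (h q) p).symm
  rw [hN, splitPoint_toSubmodule, mem_range_splitIdealMap]
  simp only [Submodule.mem_span_singleton, hcol]
  exact Classical.skolem

end Split

attribute [local instance] sectionsAlgebra

/-! ### Points and sections of the tautological powers -/

section Away

/-- The localization `R → R[1/s]` as a homomorphism of `K`-algebras. -/
noncomputable abbrev toAway (K : Type*) {R : Type*} [CommSemiring K] [CommSemiring R] [Algebra K R]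
    (s : R) : R →ₐ[K] Localization.Away s :=
  IsScalarTower.toAlgHom K R (Localization.Away s)

variable {R : Type*} [CommRing R]

lemma span_eq_top_of_forall_prime {t : Set R} (h : ∀ p : PrimeSpectrum R, ∃ s ∈ t, s ∉ p.asIdeal) :
    Ideal.span t = ⊤ := by
  by_contra hI
  obtain ⟨m, hm, hIm⟩ := Ideal.exists_le_maximal _ hI
  obtain ⟨s, hs, hsm⟩ := h ⟨m, hm.isPrime⟩
  exact hsm (hIm (Ideal.subset_span hs))

lemma eq_of_forall_prime_exists_away {x y : R}
    (h : ∀ p : PrimeSpectrum R, ∃ s ∉ p.asIdeal,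
      algebraMap R (Localization.Away s) x = algebraMap R (Localization.Away s) y) : x = y := by
  let t : Set R :=
    {s | algebraMap R (Localization.Away s) x = algebraMap R (Localization.Away s) y}
  have ht : Ideal.span t = ⊤ := span_eq_top_of_forall_prime fun p =>
    let ⟨s, hs, hxy⟩ := h p
    ⟨s, hxy, hs⟩
  exact Localization.algebraMap_injective_of_span_eq_top t ht (funext fun s => s.2)

variable {K : Type*} [CommSemiring K] [Algebra K R]

lemma exists_comp_toAway_eq {S : Type*} [CommRing S] [Algebra K S] (g : R →ₐ[K] S) {s : R}
    (hs : IsUnit (g s)) : ∃ l : Localization.Away s →ₐ[K] S, l.comp (toAway K s) = g := by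
  refine ⟨IsLocalization.liftAlgHom (M := Submonoid.powers s) (f := g) ?_, ?_⟩
  · rintro ⟨_, k, rfl⟩
    simpa using hs.pow k
  · ext x
    simp

variable (K) in
lemma exists_algebraMap_eq_of_span_eq_top {t : Set R} (ht : Ideal.span t = ⊤)
    (f : ∀ s : t, Localization.Away s.1)
    (h : ∀ (s s' : t) (l : Localization.Away s.1 →ₐ[K] Localization.Away (s.1 * s'.1))
      (l' : Localization.Away s'.1 →ₐ[K] Localization.Away (s.1 * s'.1)),
      l.comp (toAway K s.1) = toAway K (s.1 * s'.1) →
      l'.comp (toAway K s'.1) = toAway K (s.1 * s'.1) → l (f s) = l' (f s')) :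
    ∃ x : R, ∀ s : t, algebraMap R (Localization.Away s.1) x = f s := by
  refine (Localization.existsUnique_algebraMap_eq_of_span_eq_top t ht f fun s s' => ?_).exists
  have hu : IsUnit (toAway K (s.1 * s'.1) (s.1 * s'.1)) :=
    IsLocalization.Away.algebraMap_isUnit (s.1 * s'.1)
  rw [map_mul, IsUnit.mul_iff] at hu
  obtain ⟨l, hl⟩ := exists_comp_toAway_eq (toAway K (s.1 * s'.1)) hu.1
  obtain ⟨l', hl'⟩ := exists_comp_toAway_eq (toAway K (s.1 * s'.1)) hu.2
  have hright : IsLocalization.Away.awayToAwayRight (P := Localization.Away (s.1 * s'.1)) s.1 s'.1 =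
      (l : Localization.Away s.1 →+* _) := by
    refine IsLocalization.ringHom_ext (Submonoid.powers s.1) (RingHom.ext fun x => ?_)
    refine (IsLocalization.Away.awayToAwayRight_eq s.1 s'.1 x).trans ?_
    exact (DFunLike.congr_fun hl x).symm
  have hleft : IsLocalization.Away.awayToAwayLeft (P := Localization.Away (s.1 * s'.1)) s'.1 s.1 =
      (l' : Localization.Away s'.1 →+* _) := by
    refine IsLocalization.ringHom_ext (Submonoid.powers s'.1) (RingHom.ext fun x => ?_)
    refine (IsLocalization.Away.awayToAwayLeft_eq s'.1 s.1 x).trans ?_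
    exact (DFunLike.congr_fun hl' x).symm
  rw [hright, hleft]
  exact h s s' l l' hl hl'

end Away

section Points

variable {F : Type u} [Field F] {X : Over (Spec (.of F))} {A : Type u} [Ring A] [Algebra F A]
  {n : ℕ} (e : points X ≅ functor F A n)
  {R S : Type u} [CommRing R] [Algebra F R] [CommRing S] [Algebra F S]

variable (X S) in
/-- The points of the `F`-scheme `X` with values in the `F`-algebra `S`. -/
abbrev ValuedPoint : Type u := (algSpec (.of F)).obj (op (CommAlgCat.of F S)) ⟶ X

namespace ValuedPoint

/-- The underlying morphism of schemes. -/
noncomputable def hom (p : ValuedPoint X S) : Spec (.of S) ⟶ X.left := p.left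

lemma hom_injective {p q : ValuedPoint X S} (h : p.hom = q.hom) : p = q :=
  Over.OverMorphism.ext h

lemma hom_comp (p : ValuedPoint X S) :
    p.hom ≫ X.hom = Spec.map (CommRingCat.ofHom (algebraMap F S)) := Over.w p

/-- The composition of a point with `Spec S → Spec R`. -/
noncomputable def pull (f : R →ₐ[F] S) (p : ValuedPoint X R) : ValuedPoint X S :=
  (algSpec (.of F)).map (CommAlgCat.ofHom f).op ≫ p

lemma hom_pull (f : R →ₐ[F] S) (p : ValuedPoint X R) :
    (p.pull f).hom = Spec.map (CommRingCat.ofHom (f : R →+* S)) ≫ p.hom := rfl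

/-- The right ideal corresponding to a point. -/
noncomputable def ideal (p : ValuedPoint X S) : IdealPoint F A n S :=
  e.hom.app (CommAlgCat.of F S) p

lemma ideal_pull (f : R →ₐ[F] S) (p : ValuedPoint X R) :
    (p.pull f).ideal e = (p.ideal e).map f := by
  have h := e.hom.naturality (CommAlgCat.ofHom f)
  have h' := ConcreteCategory.congr_hom h p
  rw [ConcreteCategory.comp_apply, ConcreteCategory.comp_apply] at h'
  exact h'

lemma ideal_injective {p q : ValuedPoint X S} (h : p.ideal e = q.ideal e) : p = q := by
  have inv_ideal (p : ValuedPoint X S) : e.inv.app (CommAlgCat.of F S) (p.ideal e) = p :=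
    ConcreteCategory.congr_hom (e.hom_inv_id_app (CommAlgCat.of F S)) p
  rw [← inv_ideal p, h, inv_ideal]

lemma exists_ideal_eq (J : IdealPoint F A n S) : ∃ p : ValuedPoint X S, p.ideal e = J :=
  ⟨e.inv.app (CommAlgCat.of F S) J,
    ConcreteCategory.congr_hom (e.inv_hom_id_app (CommAlgCat.of F S)) J⟩

end ValuedPoint

/-- The morphism `Spec S → X` given by an affine open subset `V` and a homomorphism
`Γ(X, V) → S`. -/
noncomputable def pointOfHom {V : X.left.Opens} (hV : IsAffineOpen V) (f : Γ(X.left, V) →ₐ[F] S) :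
    ValuedPoint X S :=
  ValuedPoint.pull f (affinePoint X hV)

lemma hom_pointOfHom {V : X.left.Opens} (hV : IsAffineOpen V) (f : Γ(X.left, V) →ₐ[F] S) :
    (pointOfHom hV f).hom = Spec.map (CommRingCat.ofHom (f : Γ(X.left, V) →+* S)) ≫ hV.fromSpec :=
  rfl

lemma ideal_pointOfHom {V : X.left.Opens} (hV : IsAffineOpen V) (f : Γ(X.left, V) →ₐ[F] S) :
    (pointOfHom hV f).ideal e = (idealOfAffine e hV).map f :=
  ValuedPoint.ideal_pull e f _

lemma pull_pointOfHom {V : X.left.Opens} (hV : IsAffineOpen V) (f : Γ(X.left, V) →ₐ[F] R)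
    (g : R →ₐ[F] S) : (pointOfHom hV f).pull g = pointOfHom hV (g.comp f) := by
  refine ValuedPoint.hom_injective ?_
  rw [ValuedPoint.hom_pull, hom_pointOfHom, hom_pointOfHom, ← Category.assoc, ← Spec.map_comp]
  rfl

lemma pointOfHom_injective {V : X.left.Opens} (hV : IsAffineOpen V) {f g : Γ(X.left, V) →ₐ[F] S}
    (h : pointOfHom hV f = pointOfHom hV g) : f = g := by
  have h' := congrArg ValuedPoint.hom h
  rw [hom_pointOfHom, hom_pointOfHom, cancel_mono] at h'
  have := CommRingCat.hom_ext_iff.mp (Spec.map_injective h')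
  exact AlgHom.coe_ringHom_injective this

lemma pointOfHom_comp_res {U V : X.left.Opens} (hU : IsAffineOpen U) (hV : IsAffineOpen V)
    (h : V ≤ U) (f : Γ(X.left, V) →ₐ[F] S) :
    pointOfHom hU (f.comp (res X h)) = pointOfHom hV f := by
  refine ValuedPoint.hom_injective ?_
  rw [hom_pointOfHom, hom_pointOfHom, ← hU.map_fromSpec hV (homOfLE h).op]
  rw [← Category.assoc, ← Spec.map_comp]
  rfl

lemma pointOfHom_id {V : X.left.Opens} (hV : IsAffineOpen V) :
    pointOfHom hV (AlgHom.id F Γ(X.left, V)) = affinePoint X hV := by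
  refine ValuedPoint.hom_injective ?_
  rw [hom_pointOfHom]
  exact (congrArg (· ≫ hV.fromSpec) (Spec.map_id _)).trans (Category.id_comp _)

lemma idealOfAffine_map_res {U V : X.left.Opens} (hU : IsAffineOpen U) (hV : IsAffineOpen V)
    (h : V ≤ U) : (idealOfAffine e hU).map (res X h) = idealOfAffine e hV := by
  have hres := pointOfHom_comp_res hU hV h (AlgHom.id F Γ(X.left, V))
  rw [pointOfHom_id, AlgHom.id_comp] at hres
  have hideal := congrArg (ValuedPoint.ideal e) hres
  rw [ideal_pointOfHom] at hideal
  exact hideal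

lemma tautologicalSections_eq {V : X.left.Opens} (hV : IsAffineOpen V) :
    tautologicalSections e V = (idealOfAffine e hV).toSubmodule := by
  ext s
  constructor
  · intro hs
    have := hs V hV le_rfl
    rwa [resTensor_id] at this
  · intro hs W hW h
    rw [← idealOfAffine_map_res e hV hW h]
    exact (idealOfAffine e hV).extendTensor_mem (res X h) hs

lemma exists_eq_pointOfHom (p : ValuedPoint X S)
    {V : X.left.Opens} (hV : IsAffineOpen V) (h : Set.range p.hom ⊆ V) :
    ∃ f : Γ(X.left, V) →ₐ[F] S, p = pointOfHom hV f := by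
  have h' : Set.range p.hom ⊆ Set.range hV.fromSpec := by rwa [hV.range_fromSpec]
  let l : Spec (.of S) ⟶ Spec Γ(X.left, V) := IsOpenImmersion.lift hV.fromSpec p.hom h'
  have hl : l ≫ hV.fromSpec = p.hom := IsOpenImmersion.lift_fac _ _ _
  obtain ⟨φ, hφ⟩ := Spec.map_surjective l
  have hcomm : CommRingCat.ofHom (algebraMap F Γ(X.left, V)) ≫ φ =
      CommRingCat.ofHom (algebraMap F S) := by
    apply Spec.map_injective
    rw [Spec.map_comp, ← fromSpec_comp_hom X hV, ← Category.assoc, hφ, hl, p.hom_comp]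
  refine ⟨{ φ.hom with
    commutes' := fun r => DFunLike.congr_fun (CommRingCat.hom_ext_iff.mp hcomm) r },
      ValuedPoint.hom_injective ?_⟩
  rw [hom_pointOfHom, ← hl, ← hφ]
  rfl

lemma exists_localization_factor (p : ValuedPoint X S)
    (x : PrimeSpectrum S) {V : X.left.Opens} (hV : IsAffineOpen V) (hx : p.hom x ∈ V) :
    ∃ s : S, s ∉ x.asIdeal ∧ ∃ f : Γ(X.left, V) →ₐ[F] Localization.Away s,
      p.pull (toAway F s) = pointOfHom hV f := by
  have hx' : x ∈ (p.hom ⁻¹ᵁ V).carrier := hx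
  obtain ⟨_, ⟨s, rfl⟩, hs, hsV⟩ :=
    PrimeSpectrum.isTopologicalBasis_basic_opens.exists_subset_of_mem_open hx' (p.hom ⁻¹ᵁ V).isOpen
  refine ⟨s, hs, exists_eq_pointOfHom _ hV ?_⟩
  rintro _ ⟨y, rfl⟩
  have : PrimeSpectrum.comap (algebraMap S (Localization.Away s)) y ∈
      (PrimeSpectrum.basicOpen s : Set (PrimeSpectrum S)) := by
    rw [← PrimeSpectrum.localization_away_comap_range (Localization.Away s) s]
    exact ⟨y, rfl⟩
  exact hsV this

lemma exists_map_idealOfAffine (J : IdealPoint F A n S) (x : PrimeSpectrum S) :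
    ∃ s : S, s ∉ x.asIdeal ∧ ∃ (V : X.left.Opens) (hV : IsAffineOpen V)
      (f : Γ(X.left, V) →ₐ[F] Localization.Away s),
      (idealOfAffine e hV).map f = J.map (toAway F s) := by
  obtain ⟨p, rfl⟩ := ValuedPoint.exists_ideal_eq e J
  obtain ⟨_, ⟨V, hV, rfl⟩, hxV, -⟩ :=
    X.left.isBasis_affineOpens.exists_subset_of_mem_open (Set.mem_univ (p.hom x)) isOpen_univ
  replace hV : IsAffineOpen V := hV
  obtain ⟨s, hs, f, hf⟩ := exists_localization_factor p x hV hxV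
  refine ⟨s, hs, V, hV, f, ?_⟩
  rw [← ideal_pointOfHom, ← hf, ValuedPoint.ideal_pull]

lemma exists_common_factor {U V : X.left.Opens} (hU : IsAffineOpen U) (hV : IsAffineOpen V)
    (f : Γ(X.left, U) →ₐ[F] S) (g : Γ(X.left, V) →ₐ[F] S)
    (h : (idealOfAffine e hU).map f = (idealOfAffine e hV).map g) (x : PrimeSpectrum S) :
    ∃ s : S, s ∉ x.asIdeal ∧ ∃ (W : X.left.Opens) (_ : IsAffineOpen W) (hWU : W ≤ U) (hWV : W ≤ V)
      (k : Γ(X.left, W) →ₐ[F] Localization.Away s),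
      k.comp (res X hWU) = (toAway F s).comp f ∧ k.comp (res X hWV) = (toAway F s).comp g := by
  have hp : pointOfHom hU f = pointOfHom hV g := ValuedPoint.ideal_injective e (by
    rw [ideal_pointOfHom, ideal_pointOfHom, h])
  have hmem {U : X.left.Opens} (hU : IsAffineOpen U) (f : Γ(X.left, U) →ₐ[F] S) :
      (pointOfHom hU f).hom x ∈ U := by
    have : hU.fromSpec (Spec.map (CommRingCat.ofHom (f : Γ(X.left, U) →+* S)) x) ∈
        Set.range hU.fromSpec := ⟨_, rfl⟩
    rw [hU.range_fromSpec] at this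
    exact this
  obtain ⟨_, ⟨W, hW, rfl⟩, hxW, hWUV⟩ :=
    X.left.isBasis_affineOpens.exists_subset_of_mem_open
      (show (pointOfHom hU f).hom x ∈ ((U ⊓ V : X.left.Opens) : Set X.left) from
        ⟨hmem hU f, hp ▸ hmem hV g⟩) (U ⊓ V).isOpen
  replace hW : IsAffineOpen W := hW
  obtain ⟨s, hs, k, hk⟩ := exists_localization_factor (pointOfHom hU f) x hW hxW
  have hWU : W ≤ U := fun y hy => (hWUV hy).1
  have hWV : W ≤ V := fun y hy => (hWUV hy).2
  refine ⟨s, hs, W, hW, hWU, hWV, k, pointOfHom_injective hU ?_, pointOfHom_injective hV ?_⟩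
  · rw [pointOfHom_comp_res hU hW, ← hk, pull_pointOfHom]
  · rw [pointOfHom_comp_res hV hW, ← hk, hp, pull_pointOfHom]

end Points

section AssociatedSheaf

variable {Y : Scheme.{u}} (M N L : PresheafOfModules.{u} (Y.presheaf ⋙ forget₂ CommRingCat RingCat))

/-- The sheaf of modules associated with a presheaf of modules. -/
noncomputable def assocSheaf : Y.Modules :=
  (PresheafOfModules.sheafification (𝟙 Y.ringCatSheaf.obj)).obj M

/-- The map from a presheaf of modules to the associated sheaf, on sections. -/
noncomputable def toAssoc (U : Y.Opens) : M.obj (op U) →ₗ[Γ(Y, U)] Γ(assocSheaf M, U) :=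
  (((PresheafOfModules.sheafificationAdjunction (𝟙 Y.ringCatSheaf.obj)).unit.app M).app (op U)).hom

/-- The restriction maps of a presheaf of modules, as semilinear maps. -/
noncomputable def secRes {U V : Y.Opens} (h : V ≤ U) :
    M.obj (op U) →ₛₗ[(Y.presheaf.map (homOfLE h).op).hom] M.obj (op V) :=
  M.restrictₛₗ (homOfLE h).op

variable {M N L}

lemma secRes_secRes {U V W : Y.Opens} (h : V ≤ U) (h' : W ≤ V) (x : M.obj (op U)) :
    secRes M h' (secRes M h x) = secRes M (h'.trans h) x :=
  (M.map_comp_apply (homOfLE h).op (homOfLE h').op x).symm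

lemma toAssoc_secRes {U V : Y.Opens} (h : V ≤ U) (x : M.obj (op U)) :
    toAssoc M V (secRes M h x) = (assocSheaf M).presheaf.map (homOfLE h).op (toAssoc M U x) :=
  PresheafOfModules.naturality_apply
    ((PresheafOfModules.sheafificationAdjunction (𝟙 Y.ringCatSheaf.obj)).unit.app M)
    (homOfLE h).op x

lemma exists_secRes_eq_zero {U : Y.Opens} {x : M.obj (op U)} (h : toAssoc M U x = 0) (y : Y)
    (hy : y ∈ U) : ∃ (V : Y.Opens) (hV : V ≤ U), y ∈ V ∧ secRes M hV x = 0 := by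
  have := Presheaf.equalizerSieve_mem (Opens.grothendieckTopology Y)
    (CategoryTheory.toSheafify (Opens.grothendieckTopology Y) M.presheaf) (X := op U) x 0
    (by rw [map_zero]; exact h)
  obtain ⟨V, i, hi, hy⟩ := this y hy
  refine ⟨V, leOfHom i, hy, ?_⟩
  exact (show M.presheaf.map i.op x = M.presheaf.map i.op 0 from hi).trans (map_zero _)

lemma exists_toAssoc_eq {U : Y.Opens} (t : Γ(assocSheaf M, U)) (y : Y) (hy : y ∈ U) :
    ∃ (V : Y.Opens) (hV : V ≤ U), y ∈ V ∧
      ∃ s, toAssoc M V s = (assocSheaf M).presheaf.map (homOfLE hV).op t := by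
  have := Presheaf.imageSieve_mem (Opens.grothendieckTopology Y)
    (CategoryTheory.toSheafify (Opens.grothendieckTopology Y) M.presheaf) (U := op U) t
  obtain ⟨V, i, ⟨s, hs⟩, hy⟩ := this y hy
  exact ⟨V, leOfHom i, hy, s, hs⟩

lemma section_eq_zero_of_locally (𝓜 : Y.Modules) {U : Y.Opens} (t : Γ(𝓜, U))
    (h : ∀ y ∈ U, ∃ (V : Y.Opens) (hV : V ≤ U), y ∈ V ∧ 𝓜.presheaf.map (homOfLE hV).op t = 0) :
    t = 0 := by
  choose V hV hy h0 using h
  refine TopCat.Sheaf.eq_of_locally_eq' ⟨𝓜.presheaf, 𝓜.isSheaf⟩ (fun y : U => V y.1 y.2) U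
    (fun y => homOfLE (hV y.1 y.2)) ?_ t 0 ?_
  · intro y hyU
    exact TopologicalSpace.Opens.mem_iSup.mpr ⟨⟨y, hyU⟩, hy y hyU⟩
  · intro y
    rw [map_zero]
    exact h0 _ _

lemma map_map_section (𝓜 : Y.Modules) {U V W : Y.Opens} (h : V ≤ U) (h' : W ≤ V) (t : Γ(𝓜, U)) :
    𝓜.presheaf.map (homOfLE h').op (𝓜.presheaf.map (homOfLE h).op t) =
      𝓜.presheaf.map (homOfLE (h'.trans h)).op t := by
  rw [← ConcreteCategory.comp_apply, ← Functor.map_comp]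
  rfl

lemma assocSheaf_hom_ext {φ ψ : assocSheaf M ⟶ assocSheaf N}
    (h : ∀ U x, φ.app U (toAssoc M U x) = ψ.app U (toAssoc M U x)) : φ = ψ := by
  apply ((PresheafOfModules.sheafificationAdjunction (𝟙 Y.ringCatSheaf.obj)).homEquiv M
    (assocSheaf N)).injective
  apply PresheafOfModules.hom_ext
  intro U
  ext x
  exact h U.unop x

/-- The morphism of associated sheaves induced by a morphism of presheaves. -/
noncomputable def assocMap (f : M ⟶ N) : assocSheaf M ⟶ assocSheaf N :=
  (PresheafOfModules.sheafification (𝟙 Y.ringCatSheaf.obj)).map f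

lemma assocMap_app_toAssoc (f : M ⟶ N) (U : Y.Opens) (x : M.obj (op U)) :
    (assocMap f).app U (toAssoc M U x) = toAssoc N U (f.app (op U) x) := by
  have := (PresheafOfModules.sheafificationAdjunction (𝟙 Y.ringCatSheaf.obj)).unit.naturality f
  have := congrArg (fun g => PresheafOfModules.Hom.app g (op U) x) this
  exact this.symm

variable (M) in
/-- A presheaf of modules whose sections on affine open subsets are compatible with localization. -/
def IsLocalizing : Prop :=
  ∀ (V : Y.Opens) (_ : IsAffineOpen V) (f : Γ(Y, V)),
    IsSemilinearBaseChange (secRes M (Y.basicOpen_le f))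

lemma one_mem_of_forall_exists_basicOpen {V : Y.Opens} (hV : IsAffineOpen V) (I : Ideal Γ(Y, V))
    (h : ∀ y ∈ V, ∃ f ∈ I, y ∈ Y.basicOpen f) : (1 : Γ(Y, V)) ∈ I := by
  rw [← Ideal.eq_top_iff_one, ← Ideal.span_eq I, ← hV.iSup_basicOpen_eq_self_iff]
  refine le_antisymm (iSup_le fun f => Y.basicOpen_le _) fun y hy => ?_
  obtain ⟨f, hf, hyf⟩ := h y hy
  exact TopologicalSpace.Opens.mem_iSup.mpr ⟨⟨f, hf⟩, hyf⟩

lemma mem_basicOpen_pow {V : Y.Opens} {f : Γ(Y, V)} {y : Y} (h : y ∈ Y.basicOpen f) (k : ℕ) :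
    y ∈ Y.basicOpen (f ^ k) := by
  rcases k.eq_zero_or_pos with rfl | hk
  · rw [pow_zero, Y.basicOpen_of_isUnit isUnit_one]
    exact Y.basicOpen_le f h
  · rwa [Y.basicOpen_pow f hk]

namespace IsLocalizing

variable (hM : IsLocalizing M) (hN : IsLocalizing N)

include hM in
lemma exists_pow_smul_eq_zero {V : Y.Opens} (hV : IsAffineOpen V) (f : Γ(Y, V)) {x : M.obj (op V)}
    (hx : secRes M (Y.basicOpen_le f) x = 0) : ∃ k : ℕ, f ^ k • x = 0 :=
  (hM V hV f).exists_pow_smul_eq_zero f (hV.isLocalization_basicOpen f) hx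

include hM in
lemma exists_pow_smul_eq {V : Y.Opens} (hV : IsAffineOpen V) (f : Γ(Y, V))
    (x : M.obj (op (Y.basicOpen f))) :
    ∃ (k : ℕ) (m : M.obj (op V)), Y.presheaf.map (homOfLE (Y.basicOpen_le f)).op f ^ k • x =
      secRes M (Y.basicOpen_le f) m :=
  (hM V hV f).exists_pow_smul_eq f (hV.isLocalization_basicOpen f) x

include hM in
lemma toAssoc_injective {V : Y.Opens} (hV : IsAffineOpen V) :
    Function.Injective (toAssoc M V) := by
  rw [← LinearMap.ker_eq_bot, eq_bot_iff]
  intro x hx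
  rw [LinearMap.mem_ker] at hx
  have : (1 : Γ(Y, V)) ∈ LinearMap.ker (LinearMap.toSpanSingleton Γ(Y, V) (M.obj (op V)) x) := by
    refine one_mem_of_forall_exists_basicOpen hV _ fun y hy => ?_
    obtain ⟨U, hU, hyU, h0⟩ := exists_secRes_eq_zero hx y hy
    obtain ⟨f, hf, hyf⟩ := hV.exists_basicOpen_le ⟨y, hyU⟩ hy
    obtain ⟨k, hk⟩ := hM.exists_pow_smul_eq_zero hV f (x := x) (by
      rw [← secRes_secRes hU hf, h0, map_zero])
    exact ⟨f ^ k, hk, mem_basicOpen_pow hyf k⟩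
  simpa using this

include hM in
lemma exists_nhd_pow_smul_section_eq_zero {V : Y.Opens} (hV : IsAffineOpen V) (f : Γ(Y, V))
    (t : Γ(assocSheaf M, V))
    (ht : (assocSheaf M).presheaf.map (homOfLE (Y.basicOpen_le f)).op t = 0) {y : Y} (hy : y ∈ V) :
    ∃ (W : Y.Opens) (hW : W ≤ V), y ∈ W ∧
      ∃ k : ℕ, (assocSheaf M).presheaf.map (homOfLE hW).op (f ^ k • t) = 0 := by
  obtain ⟨U, hU, hyU, s, hs⟩ := exists_toAssoc_eq t y hy
  obtain ⟨g, hg, hyg⟩ := hV.exists_basicOpen_le ⟨y, hyU⟩ hy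
  have hD : IsAffineOpen (Y.basicOpen g) := hV.basicOpen g
  let f' : Γ(Y, Y.basicOpen g) := Y.presheaf.map (homOfLE (Y.basicOpen_le g)).op f
  have hle : Y.basicOpen f' ≤ Y.basicOpen f := by
    rw [Scheme.basicOpen_res]; exact inf_le_right
  have hs0 : secRes M (Y.basicOpen_le f') (secRes M hg s) = 0 := by
    apply hM.toAssoc_injective (hD.basicOpen f')
    rw [map_zero, secRes_secRes, toAssoc_secRes, hs, map_map_section,
      ← map_map_section _ (Y.basicOpen_le f) hle, ht, map_zero]
  obtain ⟨k, hk⟩ := hM.exists_pow_smul_eq_zero hD f' hs0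
  refine ⟨Y.basicOpen g, Y.basicOpen_le g, hyg, k, ?_⟩
  rw [Scheme.Modules.map_smul, map_pow, ← map_map_section _ hU hg, ← hs, ← toAssoc_secRes,
    ← map_smul, hk, map_zero]

include hM in
lemma exists_pow_smul_section_eq_zero {V : Y.Opens} (hV : IsAffineOpen V) (f : Γ(Y, V))
    (t : Γ(assocSheaf M, V))
    (ht : (assocSheaf M).presheaf.map (homOfLE (Y.basicOpen_le f)).op t = 0) :
    ∃ k : ℕ, f ^ k • t = 0 := by
  let IsKilledOn (s : Set Y) (k : ℕ) : Prop := ∀ y ∈ s, ∃ (W : Y.Opens) (hW : W ≤ V), y ∈ W ∧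
    (assocSheaf M).presheaf.map (homOfLE hW).op (f ^ k • t) = 0
  have killed_of_le {s : Set Y} {k l : ℕ} (hkl : k ≤ l) (hk : IsKilledOn s k) :
      IsKilledOn s l := fun y hy => by
    obtain ⟨W, hW, hyW, h⟩ := hk y hy
    refine ⟨W, hW, hyW, ?_⟩
    rw [← Nat.sub_add_cancel hkl, pow_add, mul_smul, Scheme.Modules.map_smul, h, smul_zero]
  have exists_killed : ∃ k, IsKilledOn V k := by
    refine hV.isCompact.induction_on (p := fun s => ∃ k, IsKilledOn s k) ⟨0, by simp [IsKilledOn]⟩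
      (fun s s' h ⟨k, hk⟩ => ⟨k, fun y hy => hk y (h hy)⟩) ?_ fun y hy => ?_
    · rintro s s' ⟨k, hk⟩ ⟨k', hk'⟩
      exact ⟨max k k', fun y hy => hy.elim (killed_of_le (le_max_left k k') hk y)
        (killed_of_le (le_max_right k k') hk' y)⟩
    · obtain ⟨W, hW, hyW, k, hk⟩ := hM.exists_nhd_pow_smul_section_eq_zero hV f t ht hy
      exact ⟨W, mem_nhdsWithin_of_mem_nhds (W.isOpen.mem_nhds hyW), k,
        fun z hz => ⟨W, hW, hz, hk⟩⟩
  exact exists_killed.imp fun k hk => section_eq_zero_of_locally _ _ hk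

include hM in
lemma toAssoc_surjective {V : Y.Opens} (hV : IsAffineOpen V) :
    Function.Surjective (toAssoc M V) := by
  intro t
  have : (1 : Γ(Y, V)) ∈ (LinearMap.range (toAssoc M V)).comap
      (LinearMap.toSpanSingleton Γ(Y, V) Γ(assocSheaf M, V) t) := by
    refine one_mem_of_forall_exists_basicOpen hV _ fun y hy => ?_
    obtain ⟨U, hU, hyU, s, hs⟩ := exists_toAssoc_eq t y hy
    obtain ⟨f, hf, hyf⟩ := hV.exists_basicOpen_le ⟨y, hyU⟩ hy
    obtain ⟨k, m, hm⟩ := hM.exists_pow_smul_eq hV f (secRes M hf s)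
    obtain ⟨l, hl⟩ := hM.exists_pow_smul_section_eq_zero hV f (f ^ k • t - toAssoc M V m) (by
      rw [map_sub, Scheme.Modules.map_smul, ← toAssoc_secRes, ← hm, map_smul, toAssoc_secRes, hs,
        map_map_section, map_pow, sub_self])
    refine ⟨f ^ (l + k), ⟨f ^ l • m, ?_⟩, mem_basicOpen_pow hyf _⟩
    rw [smul_sub, sub_eq_zero] at hl
    rw [map_smul, ← hl, LinearMap.toSpanSingleton_apply, pow_add, mul_smul]
  obtain ⟨x, hx⟩ := this
  exact ⟨x, hx.trans (one_smul _ t)⟩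

/-- The sections over an affine open subset of the sheaf associated with a localizing presheaf. -/
noncomputable def secEquiv {V : Y.Opens} (hV : IsAffineOpen V) :
    M.obj (op V) ≃ₗ[Γ(Y, V)] Γ(assocSheaf M, V) :=
  LinearEquiv.ofBijective (toAssoc M V) ⟨hM.toAssoc_injective hV, hM.toAssoc_surjective hV⟩

/-- The action of a morphism of sheaves on the sections over an affine open subset. -/
noncomputable def affineMap (φ : assocSheaf M ⟶ assocSheaf N) {V : Y.Opens} (hV : IsAffineOpen V) :
    M.obj (op V) →ₗ[Γ(Y, V)] N.obj (op V) :=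
  (hN.secEquiv hV).symm.toLinearMap ∘ₗ
    { toFun := fun x => φ.app V (toAssoc M V x)
      map_add' := fun x y => by rw [map_add, map_add]
      map_smul' := fun r x => by rw [map_smul, Scheme.Modules.Hom.app_smul]; rfl }

lemma toAssoc_affineMap (φ : assocSheaf M ⟶ assocSheaf N) {V : Y.Opens} (hV : IsAffineOpen V)
    (x : M.obj (op V)) : toAssoc N V (hN.affineMap φ hV x) = φ.app V (toAssoc M V x) :=
  (hN.secEquiv hV).apply_symm_apply _

lemma app_map (φ : assocSheaf M ⟶ assocSheaf N) {U V : Y.Opens} (h : V ≤ U)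
    (t : Γ(assocSheaf M, U)) : φ.app V ((assocSheaf M).presheaf.map (homOfLE h).op t) =
      (assocSheaf N).presheaf.map (homOfLE h).op (φ.app U t) :=
  ConcreteCategory.congr_hom (φ.mapPresheaf.naturality (homOfLE h).op) t

lemma affineMap_secRes (φ : assocSheaf M ⟶ assocSheaf N) {U V : Y.Opens} (hU : IsAffineOpen U)
    (hV : IsAffineOpen V) (h : V ≤ U) (x : M.obj (op U)) :
    hN.affineMap φ hV (secRes M h x) = secRes N h (hN.affineMap φ hU x) := by
  apply hN.toAssoc_injective hV
  rw [toAssoc_affineMap, toAssoc_secRes, toAssoc_secRes, toAssoc_affineMap, app_map]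

lemma affineMap_add (φ ψ : assocSheaf M ⟶ assocSheaf N) {V : Y.Opens} (hV : IsAffineOpen V)
    (x : M.obj (op V)) :
    hN.affineMap (φ + ψ) hV x = hN.affineMap φ hV x + hN.affineMap ψ hV x := by
  apply hN.toAssoc_injective hV
  rw [toAssoc_affineMap, map_add, toAssoc_affineMap, toAssoc_affineMap]
  rfl

lemma affineMap_comp (hL : IsLocalizing L) (φ : assocSheaf M ⟶ assocSheaf N)
    (ψ : assocSheaf N ⟶ assocSheaf L) {V : Y.Opens} (hV : IsAffineOpen V) (x : M.obj (op V)) :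
    hL.affineMap (φ ≫ ψ) hV x = hL.affineMap ψ hV (hN.affineMap φ hV x) := by
  apply hL.toAssoc_injective hV
  rw [toAssoc_affineMap, toAssoc_affineMap, toAssoc_affineMap]
  rfl

lemma affineMap_assocMap (f : M ⟶ N) {V : Y.Opens} (hV : IsAffineOpen V) (x : M.obj (op V)) :
    hN.affineMap (assocMap f) hV x = f.app (op V) x := by
  apply hN.toAssoc_injective hV
  rw [toAssoc_affineMap, assocMap_app_toAssoc]

lemma affineMap_id {V : Y.Opens} (hV : IsAffineOpen V) (x : M.obj (op V)) :
    hM.affineMap (𝟙 (assocSheaf M)) hV x = x := by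
  apply hM.toAssoc_injective hV
  rw [toAssoc_affineMap]
  rfl

lemma eq_zero_of_affineMap (φ : assocSheaf M ⟶ assocSheaf N)
    (h : ∀ (V : Y.Opens) (hV : IsAffineOpen V) x, hN.affineMap φ hV x = 0) : φ = 0 := by
  refine assocSheaf_hom_ext fun U x => ?_
  change φ.app U (toAssoc M U x) = 0
  refine section_eq_zero_of_locally _ _ fun y hy => ?_
  obtain ⟨_, ⟨V, hV, rfl⟩, hyV, hVU⟩ :=
    Y.isBasis_affineOpens.exists_subset_of_mem_open hy U.isOpen
  replace hV : IsAffineOpen V := hV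
  replace hVU : V ≤ U := hVU
  refine ⟨V, hVU, hyV, ?_⟩
  rw [← app_map, ← toAssoc_secRes, ← hN.toAssoc_affineMap φ hV, h, map_zero]

end IsLocalizing

end AssociatedSheaf

/-- The index set `{1, …, n} ^ k` of the coordinates on `k`-fold tensors, as an iterated product
`((Unit × Fin n) × Fin n) × …` that follows the recursion defining `tensorPower`. -/
def MultiIndex (n : ℕ) : ℕ → Type
  | 0 => Unit
  | k + 1 => MultiIndex n k × Fin n

namespace MultiIndex

instance instDecidableEq (n : ℕ) : ∀ k, DecidableEq (MultiIndex n k)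
  | 0 => inferInstanceAs (DecidableEq Unit)
  | k + 1 => letI := instDecidableEq n k; inferInstanceAs (DecidableEq (MultiIndex n k × Fin n))

instance instFintype (n : ℕ) : ∀ k, Fintype (MultiIndex n k)
  | 0 => inferInstanceAs (Fintype Unit)
  | k + 1 => letI := instFintype n k; inferInstanceAs (Fintype (MultiIndex n k × Fin n))

instance instNonempty (n : ℕ) [NeZero n] : ∀ k, Nonempty (MultiIndex n k)
  | 0 => inferInstanceAs (Nonempty Unit)
  | k + 1 => letI := instNonempty n k; inferInstanceAs (Nonempty (MultiIndex n k × Fin n))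

end MultiIndex

/-- Functions on a product of finite sets, as a tensor product of spaces of functions. -/
noncomputable def tensorPiEquiv (R ι κ : Type*) [CommSemiring R] [Finite ι] [Finite κ] :
    (ι → R) ⊗[R] (κ → R) ≃ₗ[R] (ι × κ → R) :=
  ((Pi.basisFun R ι).tensorProduct (Pi.basisFun R κ)).equivFun

lemma tensorPiEquiv_tmul {R ι κ : Type*} [CommSemiring R] [Finite ι] [Finite κ]
    (x : ι → R) (y : κ → R) (p : ι × κ) : tensorPiEquiv R ι κ (x ⊗ₜ y) p = x p.1 * y p.2 := by
  rw [tensorPiEquiv, Module.Basis.equivFun_apply, Module.Basis.tensorProduct_repr_tmul_apply,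
    Pi.basisFun_repr, Pi.basisFun_repr, smul_eq_mul, mul_comm]

section TensorPowers

variable {F : Type u} [Field F] {X : Over (Spec (.of F))} {A : Type u} [Ring A] [Algebra F A]
  {n : ℕ} (e : points X ≅ functor F A n)

/-- The presheaf `U ↦ I(U)^{⊗ k}`. -/
noncomputable abbrev powerPresheaf (k : ℕ) :
    PresheafOfModules.{u} (X.left.presheaf ⋙ forget₂ CommRingCat RingCat) :=
  tensorPower (tautologicalSubmodule e).toPresheafOfModules k

lemma isSemilinearBaseChange_tautologicalSubmodule {U V : X.left.Opens} (hU : IsAffineOpen U)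
    (hV : IsAffineOpen V) (h : V ≤ U) :
    IsSemilinearBaseChange (secRes (tautologicalSubmodule e).toPresheafOfModules h) := by
  exact (((idealOfAffine e hU).isSemilinearBaseChange_toMap (res X h)
    (idealOfAffine_map_res e hU hV h)).comp_linearEquiv
      (LinearEquiv.ofEq _ _ (tautologicalSections_eq e hV).symm)).comp_linearEquiv_left
      (LinearEquiv.ofEq _ _ (tautologicalSections_eq e hU))

lemma isSemilinearBaseChange_powerPresheaf {U V : X.left.Opens} (hU : IsAffineOpen U)
    (hV : IsAffineOpen V) (h : V ≤ U) :
    ∀ k, IsSemilinearBaseChange (secRes (powerPresheaf e k) h)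
  | 0 => by exact IsSemilinearBaseChange.ringHom (σ := (X.left.presheaf.map (homOfLE h).op).hom)
  | k + 1 => by
    exact (isSemilinearBaseChange_powerPresheaf hU hV h k).tensorMap
      (isSemilinearBaseChange_tautologicalSubmodule e hU hV h)

lemma isLocalizing_powerPresheaf (k : ℕ) : IsLocalizing (powerPresheaf e k) :=
  fun _ hV f => isSemilinearBaseChange_powerPresheaf e hV (hV.basicOpen f) _ k

variable {K : Type u} [Field K] [Algebra F K] (θ : K ⊗[F] A ≃ₐ[K] Matrix (Fin n) (Fin n) K)
  {R S : Type u} [CommRing R] [Algebra F R] [Algebra K R] [IsScalarTower F K R]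
  [CommRing S] [Algebra F S] [Algebra K S] [IsScalarTower F K S]

/-- Coordinates of the sections of the tautological sheaf at an `R`-valued point `u`. If the ideal
at `u` consists of the matrices `v wᵀ` and `c ⬝ᵥ v = 1`, the coordinates of `v wᵀ` are `w`. -/
noncomputable def coordOne {V : X.left.Opens} (u : Γ(X.left, V) →ₐ[F] R) (c : Fin n → R) :
    (tautologicalSubmodule e).toPresheafOfModules.obj (op V) →ₛₗ[(u : Γ(X.left, V) →+* R)]
      (Fin n → R) :=
  ((splitCoord θ c).comp (extendTensor A u)).comp (tautologicalSections e V).subtype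

/-- Coordinates of the sections of the tensor powers of the tautological sheaf at an `R`-valued
point `u`: the tensor powers of `coordOne`. -/
noncomputable def coord {V : X.left.Opens} (u : Γ(X.left, V) →ₐ[F] R) (c : Fin n → R) : ∀ k,
    (powerPresheaf e k).obj (op V) →ₛₗ[(u : Γ(X.left, V) →+* R)] (MultiIndex n k → R)
  | 0 => (LinearMap.pi fun _ => LinearMap.id).comp (u : Γ(X.left, V) →+* R).toSemilinearMap
  | k + 1 => (tensorPiEquiv R (MultiIndex n k) (Fin n)).toLinearMap.comp
      (TensorProduct.map (coord u c k) (coordOne e θ u c))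

/-- The product of sections of `I^{⊗ k}` and `I`. -/
noncomputable def tmulSec {V : X.left.Opens} {k : ℕ} (s : (powerPresheaf e k).obj (op V))
    (x : (tautologicalSubmodule e).toPresheafOfModules.obj (op V)) :
    (powerPresheaf e (k + 1)).obj (op V) :=
  TensorProduct.tmul Γ(X.left, V) s x

variable {e} in
lemma power_induction {V : X.left.Opens} {k : ℕ}
    {p : (powerPresheaf e (k + 1)).obj (op V) → Prop} (x) (h0 : p 0)
    (hadd : ∀ x y, p x → p y → p (x + y)) (hmul : ∀ s x, p (tmulSec e s x)) : p x := by
  refine TensorProduct.induction_on (motive := p) x h0 hmul hadd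

lemma secRes_tmulSec {U V : X.left.Opens} (h : V ≤ U) {k : ℕ}
    (s : (powerPresheaf e k).obj (op U))
    (x : (tautologicalSubmodule e).toPresheafOfModules.obj (op U)) :
    secRes (powerPresheaf e (k + 1)) h (tmulSec e s x) =
      tmulSec e (secRes (powerPresheaf e k) h s) (secRes _ h x) := rfl

lemma coordOne_apply {V : X.left.Opens} (u : Γ(X.left, V) →ₐ[F] R) (c : Fin n → R)
    (x : tautologicalSections e V) :
    coordOne e θ u c x = splitCoord θ c (extendTensor A u x) := rfl

lemma coordOne_comp_res {U V : X.left.Opens} (h : V ≤ U) (u : Γ(X.left, V) →ₐ[F] R)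
    (c : Fin n → R) (x : (tautologicalSubmodule e).toPresheafOfModules.obj (op U)) :
    coordOne e θ (u.comp (res X h)) c x = coordOne e θ u c (secRes _ h x) :=
  congrArg (splitCoord θ c) (extendTensor_comp_apply (res X h) u _)

lemma coordOne_comp {V : X.left.Opens} (u : Γ(X.left, V) →ₐ[F] R) (c : Fin n → R)
    (g : R →ₐ[K] S) (x : (tautologicalSubmodule e).toPresheafOfModules.obj (op V)) :
    coordOne e θ ((g.restrictScalars F).comp u) (g ∘ c) x = g ∘ coordOne e θ u c x := by
  refine (congrArg (splitCoord θ (g ∘ c)) (extendTensor_comp_apply _ _ _)).trans ?_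
  rw [splitCoord_apply, splitEquiv_extendTensor]
  exact funext fun i => ((g : R →+* S).map_vecMul _ _ i).symm

lemma coordOne_smul {V : X.left.Opens} (u : Γ(X.left, V) →ₐ[F] R) (c : Fin n → R) (r : R)
    (x : (tautologicalSubmodule e).toPresheafOfModules.obj (op V)) :
    coordOne e θ u (r • c) x = r • coordOne e θ u c x :=
  Matrix.smul_vecMul r c (splitEquiv θ R (extendTensor A u
    (Subtype.val (p := (· ∈ tautologicalSections e V)) x)))

lemma coord_tmulSec {V : X.left.Opens} (u : Γ(X.left, V) →ₐ[F] R) (c : Fin n → R) {k : ℕ}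
    (s : (powerPresheaf e k).obj (op V))
    (x : (tautologicalSubmodule e).toPresheafOfModules.obj (op V)) (i : MultiIndex n (k + 1)) :
    coord e θ u c (k + 1) (tmulSec e s x) i = coord e θ u c k s i.1 * coordOne e θ u c x i.2 :=
  tensorPiEquiv_tmul _ _ _

lemma coord_comp_res {U V : X.left.Opens} (h : V ≤ U) (u : Γ(X.left, V) →ₐ[F] R)
    (c : Fin n → R) : ∀ (k : ℕ) (x : (powerPresheaf e k).obj (op U)),
    coord e θ (u.comp (res X h)) c k x = coord e θ u c k (secRes (powerPresheaf e k) h x)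
  | 0, x => rfl
  | k + 1, x => by
    induction x using power_induction with
    | h0 => rw [map_zero, map_zero, map_zero]
    | hadd x y hx hy => rw [map_add, map_add, map_add, hx, hy]
    | hmul s x =>
      ext i
      rw [secRes_tmulSec, coord_tmulSec, coord_tmulSec, coord_comp_res h u c k, coordOne_comp_res]

lemma coord_comp {V : X.left.Opens} (u : Γ(X.left, V) →ₐ[F] R) (c : Fin n → R) (g : R →ₐ[K] S) :
    ∀ (k : ℕ) (x : (powerPresheaf e k).obj (op V)),
    coord e θ ((g.restrictScalars F).comp u) (g ∘ c) k x = g ∘ coord e θ u c k x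
  | 0, x => rfl
  | k + 1, x => by
    induction x using power_induction with
    | h0 => rw [map_zero, map_zero]; ext; simp
    | hadd x y hx hy => rw [map_add, map_add, hx, hy]; ext; simp
    | hmul s x =>
      ext i
      rw [coord_tmulSec, coord_comp u c g k, coordOne_comp, Function.comp_apply,
        Function.comp_apply, Function.comp_apply, coord_tmulSec, map_mul]

lemma coord_smul {V : X.left.Opens} (u : Γ(X.left, V) →ₐ[F] R) (c : Fin n → R) (r : R) :
    ∀ (k : ℕ) (x : (powerPresheaf e k).obj (op V)),
    coord e θ u (r • c) k x = r ^ k • coord e θ u c k x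
  | 0, x => by rw [pow_zero, one_smul]; rfl
  | k + 1, x => by
    induction x using power_induction with
    | h0 => rw [map_zero, map_zero, smul_zero]
    | hadd x y hx hy => rw [map_add, map_add, hx, hy, smul_add]
    | hmul s x =>
      ext i
      rw [coord_tmulSec, coord_smul u c r k, coordOne_smul, Pi.smul_apply, Pi.smul_apply,
        Pi.smul_apply, coord_tmulSec, smul_eq_mul, smul_eq_mul, smul_eq_mul]
      ring

variable [FiniteDimensional F A]

lemma coordOne_congr {V : X.left.Opens} (hV : IsAffineOpen V) (u : Γ(X.left, V) →ₐ[F] R)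
    {v c c' : Fin n → R} (hc : c ⬝ᵥ v = 1) (hc' : c' ⬝ᵥ v = 1)
    (h : (idealOfAffine e hV).map u = splitPoint θ v ⟨c, hc⟩)
    (x : (tautologicalSubmodule e).toPresheafOfModules.obj (op V)) :
    coordOne e θ u c x = coordOne e θ u c' x := by
  obtain ⟨x, hx⟩ := x
  have hx' : x ∈ (idealOfAffine e hV).toSubmodule := tautologicalSections_eq e hV ▸ hx
  have hux := (idealOfAffine e hV).extendTensor_mem u hx'
  rw [h, splitPoint_toSubmodule] at hux
  obtain ⟨w, hw⟩ := hux
  refine (coordOne_apply e θ u c ⟨x, hx⟩).trans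
    (Eq.trans ?_ (coordOne_apply e θ u c' ⟨x, hx⟩).symm)
  simp only
  rw [← hw, splitCoord_splitIdealMap θ hc, splitCoord_splitIdealMap θ hc']

lemma coord_congr {V : X.left.Opens} (hV : IsAffineOpen V) (u : Γ(X.left, V) →ₐ[F] R)
    {v c c' : Fin n → R} (hc : c ⬝ᵥ v = 1) (hc' : c' ⬝ᵥ v = 1)
    (h : (idealOfAffine e hV).map u = splitPoint θ v ⟨c, hc⟩) :
    ∀ (k : ℕ) (x : (powerPresheaf e k).obj (op V)), coord e θ u c k x = coord e θ u c' k x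
  | 0, x => rfl
  | k + 1, x => by
    induction x using power_induction with
    | h0 => rw [map_zero, map_zero]
    | hadd x y hx hy => rw [map_add, map_add, hx, hy]
    | hmul s x =>
      ext i
      rw [coord_tmulSec, coord_tmulSec, coord_congr hV u hc hc' h k,
        coordOne_congr e θ hV u hc hc' h]

lemma isSemilinearBaseChange_coordOne {V : X.left.Opens} (hV : IsAffineOpen V)
    (u : Γ(X.left, V) →ₐ[F] R) {v c : Fin n → R} (hc : c ⬝ᵥ v = 1)
    (h : (idealOfAffine e hV).map u = splitPoint θ v ⟨c, hc⟩) :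
    IsSemilinearBaseChange (coordOne e θ u c) :=
  (((idealOfAffine e hV).isSemilinearBaseChange_toMap u h).comp_linearEquiv
    (rangeSplitIdealMapEquiv θ hc)).comp_linearEquiv_left
    (LinearEquiv.ofEq _ _ (tautologicalSections_eq e hV))

lemma isSemilinearBaseChange_coord {V : X.left.Opens} (hV : IsAffineOpen V)
    (u : Γ(X.left, V) →ₐ[F] R) {v c : Fin n → R} (hc : c ⬝ᵥ v = 1)
    (h : (idealOfAffine e hV).map u = splitPoint θ v ⟨c, hc⟩) :
    ∀ k, IsSemilinearBaseChange (coord e θ u c k)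
  | 0 => (IsSemilinearBaseChange.ringHom (σ := (u : Γ(X.left, V) →+* R))).comp_linearEquiv
      (LinearEquiv.funUnique Unit R R).symm
  | k + 1 => by
    exact ((isSemilinearBaseChange_coord hV u hc h k).tensorMap
      (isSemilinearBaseChange_coordOne e θ hV u hc h)).comp_linearEquiv
      (tensorPiEquiv R (MultiIndex n k) (Fin n))

end TensorPowers

/-! ### Morphisms of tautological powers as matrices -/

lemma map_mulVec_comp {ι κ R S G : Type*} [Fintype κ] [NonAssocSemiring R] [NonAssocSemiring S]
    [FunLike G R S] [RingHomClass G R S] (M : Matrix ι κ R) (g : G) (x : κ → R) :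
    (M.map g).mulVec (g ∘ x) = g ∘ M.mulVec x :=
  funext fun i => ((g : R →+* S).map_mulVec M x i).symm

section Act

variable {F : Type u} [Field F] {X : Over (Spec (.of F))} {A : Type u} [Ring A] [Algebra F A]
  {n : ℕ} (e : points X ≅ functor F A n) {i j : ℕ}

/-- The action of a morphism `I^{⊗ i} ⟶ I^{⊗ j}` on sections over an affine open subset. -/
noncomputable abbrev act
    (φ : assocSheaf (powerPresheaf e i) ⟶ assocSheaf (powerPresheaf e j)) {V : X.left.Opens}
    (hV : IsAffineOpen V) :
    (powerPresheaf e i).obj (op V) →ₗ[Γ(X.left, V)] (powerPresheaf e j).obj (op V) :=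
  (isLocalizing_powerPresheaf e j).affineMap φ hV

variable {e} {K : Type u} [Field K] [Algebra F K] {θ : K ⊗[F] A ≃ₐ[K] Matrix (Fin n) (Fin n) K}
  {R : Type u} [CommRing R] [Algebra F R] [Algebra K R] [IsScalarTower F K R]
  {φ : assocSheaf (powerPresheaf e i) ⟶ assocSheaf (powerPresheaf e j)}

lemma coord_act_of_forall_secRes {V W : X.left.Opens} (hV : IsAffineOpen V) (hW : IsAffineOpen W)
    (hWV : W ≤ V) (u : Γ(X.left, W) →ₐ[F] R) (c : Fin n → R)
    (M : Matrix (MultiIndex n j) (MultiIndex n i) R)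
    (h : ∀ x, coord e θ u c j (secRes _ hWV (act e φ hV x)) =
      M.mulVec (coord e θ u c i (secRes _ hWV x))) (x) :
    coord e θ u c j (act e φ hW x) = M.mulVec (coord e θ u c i x) := by
  have hspan := (isSemilinearBaseChange_powerPresheaf e hV hW hWV i).span_range
  refine DFunLike.congr_fun (f := (coord e θ u c j).comp (act e φ hW))
    (g := M.mulVecLin.comp (coord e θ u c i)) (LinearMap.ext_on_range hspan fun y => ?_) x
  exact (congrArg _ (IsLocalizing.affineMap_secRes _ φ hV hW hWV y)).trans (h y)

end Act

section Matrices

variable {F : Type u} [Field F] {X : Over (Spec (.of F))} {A : Type u} [Ring A] [Algebra F A]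
  [FiniteDimensional F A] {n : ℕ} (e : points X ≅ functor F A n)
  {K : Type u} [Field K] [Algebra F K] (θ : K ⊗[F] A ≃ₐ[K] Matrix (Fin n) (Fin n) K)
  {R S : Type u} [CommRing R] [Algebra K R] [CommRing S] [Algebra K S] {i j k : ℕ}

/-- The matrix `M` describes the morphism `φ : I^{⊗ i} ⟶ I^{⊗ j}` at the right ideal given by
the unimodular vector `v`. To make this independent of choices, the definition refers to all
extensions of scalars `g` after which the point factors through an affine open subset. -/
def IsMatrixAt (φ : assocSheaf (powerPresheaf e i) ⟶ assocSheaf (powerPresheaf e j))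
    (v : Fin n → R) (M : Matrix (MultiIndex n j) (MultiIndex n i) R) : Prop :=
  ∀ (S : Type u) [CommRing S] [Algebra F S] [Algebra K S] [IsScalarTower F K S] (g : R →ₐ[K] S)
    (V : X.left.Opens) (hV : IsAffineOpen V) (u : Γ(X.left, V) →ₐ[F] S) (c : Fin n → S)
    (hc : c ⬝ᵥ (g ∘ v) = 1), (idealOfAffine e hV).map u = splitPoint θ (g ∘ v) ⟨c, hc⟩ →
    ∀ x, coord e θ u c j (act e φ hV x) = (M.map g).mulVec (coord e θ u c i x)

variable {e θ} {φ ψ : assocSheaf (powerPresheaf e i) ⟶ assocSheaf (powerPresheaf e j)}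
  {χ : assocSheaf (powerPresheaf e j) ⟶ assocSheaf (powerPresheaf e k)}
  {v : Fin n → R} {M N : Matrix (MultiIndex n j) (MultiIndex n i) R}
  {L : Matrix (MultiIndex n k) (MultiIndex n j) R}

namespace IsMatrixAt

lemma map (h : IsMatrixAt e θ φ v M) (f : R →ₐ[K] S) : IsMatrixAt e θ φ (f ∘ v) (M.map f) := by
  intro T _ _ _ _ g V hV u c hc hJ x
  rw [h T (g.comp f) V hV u c hc hJ x, Matrix.map_map]
  rfl

lemma add (h : IsMatrixAt e θ φ v M) (h' : IsMatrixAt e θ ψ v N) :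
    IsMatrixAt e θ (φ + ψ) v (M + N) := by
  intro T _ _ _ _ g V hV u c hc hJ x
  rw [IsLocalizing.affineMap_add, map_add, h T g V hV u c hc hJ, h' T g V hV u c hc hJ,
    Matrix.map_add _ (map_add g), Matrix.add_mulVec]

lemma comp (h : IsMatrixAt e θ φ v M) (h' : IsMatrixAt e θ χ v L) :
    IsMatrixAt e θ (φ ≫ χ) v (L * M) := by
  intro T _ _ _ _ g V hV u c hc hJ x
  have hmul : (L * M).map g = L.map g * M.map g := Matrix.map_mul (f := (g : R →+* T))
  rw [IsLocalizing.affineMap_comp (isLocalizing_powerPresheaf e j), h' T g V hV u c hc hJ,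
    h T g V hV u c hc hJ, hmul, Matrix.mulVec_mulVec]

lemma id (v : Fin n → R) :
    IsMatrixAt e θ (𝟙 (assocSheaf (powerPresheaf e i))) v 1 := by
  intro T _ _ _ _ g V hV u c hc _ x
  rw [IsLocalizing.affineMap_id, Matrix.map_one _ (map_zero g) (map_one g), Matrix.one_mulVec]

lemma of_local {t : Set R} (ht : Ideal.span t = ⊤)
    (h : ∀ s ∈ t, IsMatrixAt e θ φ (toAway K s ∘ v) (M.map (toAway K s))) :
    IsMatrixAt e θ φ v M := by
  intro S _ _ _ _ g V hV u c hc hJ x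
  refine funext fun q => eq_of_forall_prime_exists_away fun p => ?_
  obtain ⟨s, hs, hsp⟩ : ∃ s ∈ t, g s ∉ p.asIdeal := by
    by_contra! hcon
    have : Ideal.span t ≤ p.asIdeal.comap (g : R →+* S) := Ideal.span_le.mpr hcon
    rw [ht, top_le_iff] at this
    exact p.2.ne_top (Ideal.comap_eq_top_iff.mp this)
  refine ⟨g s, hsp, ?_⟩
  let a : S →ₐ[K] Localization.Away (g s) := toAway K (g s)
  obtain ⟨l, hl⟩ := exists_comp_toAway_eq (a.comp g) (s := s)
    (IsLocalization.Away.algebraMap_isUnit (g s))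
  have hlv (x : R) : l (toAway K s x) = a (g x) := DFunLike.congr_fun hl x
  have hla : l ∘ (toAway K s ∘ v) = a ∘ (g ∘ v) := funext fun x => hlv _
  have hca := comp_dotProduct_comp_eq_one hc a
  have hx := h s hs _ l V hV ((a.restrictScalars F).comp u) (a ∘ c) (by rw [hla, hca]) (by
    rw [IdealPoint.map_comp, hJ, splitPoint_map]
    congr 1
    exact hla.symm) x
  have hMl : (M.map (toAway K s)).map l = (M.map g).map a := Matrix.ext fun _ _ => hlv _
  rw [hMl, coord_comp, coord_comp, map_mulVec_comp] at hx
  exact congrFun hx q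

variable [Algebra F R] [IsScalarTower F K R]

lemma of_affine {V : X.left.Opens} (hV : IsAffineOpen V) (u : Γ(X.left, V) →ₐ[F] R)
    {c : Fin n → R} (hc : c ⬝ᵥ v = 1) (hJ : (idealOfAffine e hV).map u = splitPoint θ v ⟨c, hc⟩)
    (h : ∀ x, coord e θ u c j (act e φ hV x) = M.mulVec (coord e θ u c i x)) :
    IsMatrixAt e θ φ v M := by
  intro S _ _ _ _ g W hW u' c' hc' hJ' x
  refine funext fun q => eq_of_forall_prime_exists_away fun p => ?_
  have hJg : (idealOfAffine e hV).map ((g.restrictScalars F).comp u) =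
      (idealOfAffine e hW).map u' := by
    rw [IdealPoint.map_comp, hJ, splitPoint_map, hJ']
  obtain ⟨s, hs, W', hW', hWV, hWW, l, hl, hl'⟩ := exists_common_factor e hV hW _ _ hJg p
  refine ⟨s, hs, ?_⟩
  let a : S →ₐ[K] Localization.Away s := toAway K s
  have hlV : l.comp (res X hWV) = ((a.comp g).restrictScalars F).comp u := hl
  have hlW : l.comp (res X hWW) = (a.restrictScalars F).comp u' := hl'
  have hcg := comp_dotProduct_comp_eq_one hc (a.comp g)
  have hca : (a ∘ c') ⬝ᵥ (a.comp g ∘ v) = 1 := comp_dotProduct_comp_eq_one hc' a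
  have hJa : (idealOfAffine e hV).map (((a.comp g).restrictScalars F).comp u) =
      splitPoint θ (a.comp g ∘ v) ⟨a ∘ c', hca⟩ := by
    rw [IdealPoint.map_comp, hJ, splitPoint_map]
  have hW'x := coord_act_of_forall_secRes hV hW' hWV l (a ∘ c') (M.map (a.comp g)) (fun y => by
    rw [← coord_comp_res, ← coord_comp_res, hlV, coord_congr e θ hV _ hca hcg hJa,
      coord_congr e θ hV _ hca hcg hJa, coord_comp, coord_comp, h, map_mulVec_comp])
    (secRes (powerPresheaf e i) hWW x)
  have hMa : M.map (a.comp g) = (M.map g).map a := by rw [Matrix.map_map]; rfl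
  rw [IsLocalizing.affineMap_secRes _ φ hW hW', ← coord_comp_res, ← coord_comp_res, hlW,
    coord_comp, coord_comp, hMa, map_mulVec_comp] at hW'x
  exact congrFun hW'x q

lemma exists_affine (e : points X ≅ functor F A n) {c : Fin n → R} (hc : c ⬝ᵥ v = 1)
    (p : PrimeSpectrum R) : ∃ s ∉ p.asIdeal, ∃ (V : X.left.Opens) (hV : IsAffineOpen V)
      (u : Γ(X.left, V) →ₐ[F] Localization.Away s) (hc' : (toAway K s ∘ c) ⬝ᵥ (toAway K s ∘ v) = 1),
      (idealOfAffine e hV).map u = splitPoint θ (toAway K s ∘ v) ⟨_, hc'⟩ := by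
  obtain ⟨s, hs, V, hV, u, hu⟩ := exists_map_idealOfAffine e (splitPoint θ v ⟨c, hc⟩) p
  refine ⟨s, hs, V, hV, u, comp_dotProduct_comp_eq_one hc (toAway K s), ?_⟩
  rw [hu]
  exact splitPoint_map θ (toAway K s) v _

lemma unique (hv : IsUnimodular v) (h : IsMatrixAt e θ φ v M) (h' : IsMatrixAt e θ φ v N) :
    M = N := by
  obtain ⟨c, hc⟩ := hv
  ext a b
  refine eq_of_forall_prime_exists_away fun p => ?_
  obtain ⟨s, hs, V, hV, u, hc', hJ⟩ := exists_affine (θ := θ) e hc p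
  refine ⟨s, hs, ?_⟩
  have hbc := isSemilinearBaseChange_coord e θ hV u hc' hJ i
  have hlin : (M.map (toAway K s)).mulVecLin = (N.map (toAway K s)).mulVecLin :=
    hbc.hom_ext fun x => (h _ _ V hV u _ hc' hJ x).symm.trans (h' _ _ V hV u _ hc' hJ x)
  exact congrFun₂ (Matrix.mulVec_injective (congrArg DFunLike.coe hlin)) a b

lemma exists_of_affine {V : X.left.Opens} (hV : IsAffineOpen V) (u : Γ(X.left, V) →ₐ[F] R)
    {c : Fin n → R} (hc : c ⬝ᵥ v = 1) (hJ : (idealOfAffine e hV).map u = splitPoint θ v ⟨c, hc⟩)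
    (φ : assocSheaf (powerPresheaf e i) ⟶ assocSheaf (powerPresheaf e j)) :
    ∃ M, IsMatrixAt e θ φ v M := by
  obtain ⟨h, hh, -⟩ := isSemilinearBaseChange_coord e θ hV u hc hJ i (MultiIndex n j → R)
    ((coord e θ u c j).comp (act e φ hV))
  refine ⟨LinearMap.toMatrix' h, of_affine hV u hc hJ fun x => ?_⟩
  rw [LinearMap.toMatrix'_mulVec, hh]
  rfl

end IsMatrixAt

variable [Algebra F R] [IsScalarTower F K R]

theorem exists_isMatrixAt (e : points X ≅ functor F A n)
    (θ : K ⊗[F] A ≃ₐ[K] Matrix (Fin n) (Fin n) K) (hv : IsUnimodular v)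
    (φ : assocSheaf (powerPresheaf e i) ⟶ assocSheaf (powerPresheaf e j)) :
    ∃ M, IsMatrixAt e θ φ v M := by
  let t : Set R := {s | ∃ M, IsMatrixAt e θ φ (toAway K s ∘ v) M}
  have ht : Ideal.span t = ⊤ := span_eq_top_of_forall_prime fun p => by
    obtain ⟨s, hs, V, hV, u, hc', hJ⟩ := IsMatrixAt.exists_affine (θ := θ) e hv.choose_spec p
    exact ⟨s, IsMatrixAt.exists_of_affine hV u hc' hJ φ, hs⟩
  choose M hM using fun s : t => s.2
  have hglue (q : MultiIndex n j) (r : MultiIndex n i) :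
      ∃ x : R, ∀ s : t, algebraMap R (Localization.Away s.1) x = M s q r := by
    refine exists_algebraMap_eq_of_span_eq_top K ht (fun s => M s q r) fun s s' l l' hl hl' => ?_
    have hMl := (hM s).map l
    have hMl' := (hM s').map l'
    have hlv : l ∘ (toAway K s.1 ∘ v) = toAway K (s.1 * s'.1) ∘ v :=
      funext fun x => DFunLike.congr_fun hl (v x)
    have hlv' : l' ∘ (toAway K s'.1 ∘ v) = toAway K (s.1 * s'.1) ∘ v :=
      funext fun x => DFunLike.congr_fun hl' (v x)
    rw [hlv] at hMl
    rw [hlv'] at hMl'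
    exact congrFun₂ (IsMatrixAt.unique (hv.map (toAway K (s.1 * s'.1))) hMl hMl') q r
  choose m hm using hglue
  refine ⟨Matrix.of m, IsMatrixAt.of_local ht fun s hs => ?_⟩
  have : (Matrix.of m).map (toAway K s) = M ⟨s, hs⟩ := by
    ext q r
    exact hm q r ⟨s, hs⟩
  rw [this]
  exact hM ⟨s, hs⟩

end Matrices

section Laurent

open Polynomial LaurentPolynomial

variable {R : Type*}

section Coeff

variable [Semiring R] (p : R[X])

lemma coeff_toLaurent_natCast (m : ℕ) : (toLaurent p).coeff (m : ℤ) = p.coeff m := by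
  rw [coeff_toLaurent]
  exact Finsupp.mapDomain_apply Nat.cast_injective _ m

lemma coeff_toLaurent_of_neg {m : ℤ} (hm : m < 0) : (toLaurent p).coeff m = 0 := by
  rw [coeff_toLaurent]
  refine Finsupp.mapDomain_of_notMem_range _ _ ?_
  rintro ⟨k, rfl⟩
  exact absurd hm (not_lt.mpr (Int.natCast_nonneg k))

end Coeff

lemma eq_C_of_invert_toLaurent_eq [CommSemiring R] {p q : R[X]}
    (h : invert (toLaurent q) = toLaurent p) :
    p = Polynomial.C (p.coeff 0) ∧ q = Polynomial.C (p.coeff 0) := by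
  have hcoeff (m : ℤ) : (toLaurent q).coeff (-m) = (toLaurent p).coeff m := by
    rw [← invert_apply, h]
  constructor <;> ext m <;> rw [Polynomial.coeff_C] <;> split_ifs with hm
  · rw [hm]
  · rw [← coeff_toLaurent_natCast, ← hcoeff, coeff_toLaurent_of_neg]
    omega
  · rw [hm, ← coeff_toLaurent_natCast, ← coeff_toLaurent_natCast, ← hcoeff]
    simp
  · rw [← coeff_toLaurent_natCast, ← neg_neg (m : ℤ), hcoeff, coeff_toLaurent_of_neg]
    omega

-- The gluing condition for a section of the line bundle of degree `-d` on the projective line.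
lemma exists_eq_C_of_invert_toLaurent_eq_T_mul [CommSemiring R] {p q : R[X]} {d : ℕ}
    (h : invert (toLaurent q) = LaurentPolynomial.T d * toLaurent p) :
    ∃ z, p = Polynomial.C z ∧ q = Polynomial.C z ∧ (0 < d → z = 0) := by
  rw [← toLaurent_X_pow, ← map_mul] at h
  obtain ⟨hp, hq⟩ := eq_C_of_invert_toLaurent_eq h
  rcases d.eq_zero_or_pos with rfl | hd
  · rw [pow_zero, one_mul] at hp hq
    exact ⟨_, hp, hq, fun h0 => absurd h0 (lt_irrefl 0)⟩
  · rw [Polynomial.coeff_X_pow_mul', if_neg (by omega), map_zero] at hp hq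
    refine ⟨0, ?_, by rw [hq, map_zero], fun _ => rfl⟩
    ext m
    have hm := congrArg (fun f => Polynomial.coeff f (m + d)) hp
    simpa [Polynomial.coeff_X_pow_mul] using hm

end Laurent

section Pencil

open Polynomial LaurentPolynomial

variable {ι R : Type*} [CommSemiring R] (a b : ι → R)

/-- The pencil of vectors `a + X b`. Together with `pencil b a`, in the coordinate `X⁻¹`, it covers
the projective line through `a` and `b`. -/
noncomputable def pencil : ι → R[X] :=
  Polynomial.C ∘ a + (Polynomial.X : R[X]) • Polynomial.C ∘ b

lemma isUnimodular_pencil [Fintype ι] {a b c : ι → R} (hca : c ⬝ᵥ a = 1) (hcb : c ⬝ᵥ b = 0) :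
    IsUnimodular (pencil a b) := by
  refine ⟨Polynomial.C ∘ c, ?_⟩
  rw [pencil, dotProduct_add, dotProduct_smul, ← RingHom.map_dotProduct, ← RingHom.map_dotProduct,
    hca, hcb, map_one, map_zero, smul_zero, add_zero]

lemma eval_pencil (r : R) (x : ι) : (pencil a b x).eval r = (a + r • b) x := by
  simp only [pencil, Pi.add_apply, Pi.smul_apply, Function.comp_apply, eval_add, eval_C,
    eval_X, smul_eq_mul, eval_mul]

lemma invert_toLaurent_pencil (x : ι) :
    invert (toLaurent (pencil b a x)) = T (-1) * toLaurent (pencil a b x) := by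
  simp [pencil, mul_add, ← mul_assoc, add_comm]

end Pencil

section ConstantMatrices

variable {F : Type u} [Field F] {X : Over (Spec (.of F))} {A : Type u} [Ring A] [Algebra F A]
  [FiniteDimensional F A] {n : ℕ} {e : points X ≅ functor F A n}
  {K : Type u} [Field K] [Algebra F K] {θ : K ⊗[F] A ≃ₐ[K] Matrix (Fin n) (Fin n) K}
  {R : Type u} [CommRing R] [Algebra K R]
  {i j : ℕ} {φ : assocSheaf (powerPresheaf e i) ⟶ assocSheaf (powerPresheaf e j)}
  {v : Fin n → R} {M : Matrix (MultiIndex n j) (MultiIndex n i) R}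

lemma IsMatrixAt.smul (h : IsMatrixAt e θ φ v M) (r : Rˣ) :
    IsMatrixAt e θ φ ((r : R) • v) (((r ^ (i - j : ℤ) : Rˣ) : R) • M) := by
  intro S _ _ _ _ g V hV u c hc hJ x
  let ρ : Sˣ := Units.map (g : R →* S) r
  have hρ : g ∘ ((r : R) • v) = (ρ : S) • (g ∘ v) := by
    ext; simp [ρ]
  have hc' : ((ρ : S) • c) ⬝ᵥ (g ∘ v) = 1 := by
    rw [smul_dotProduct, ← dotProduct_smul, ← hρ, hc]
  have hJ' : (idealOfAffine e hV).map u = splitPoint θ (g ∘ v) ⟨_, hc'⟩ := by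
    rw [hJ, ← splitPoint_smul θ (g ∘ v) ⟨_, hc'⟩ ρ (by rw [← hρ]; exact ⟨c, hc⟩)]
    congr 1
  have hx : ρ ^ (j : ℤ) • coord e θ u c j (act e φ hV x) =
      ρ ^ (i : ℤ) • (M.map g).mulVec (coord e θ u c i x) := by
    have hx := h S g V hV u _ hc' hJ' x
    rw [coord_smul, coord_smul, Matrix.mulVec_smul] at hx
    simpa [Units.smul_def] using hx
  have hM : (((r ^ (i - j : ℤ) : Rˣ) : R) • M).map g =
      ((ρ ^ (i - j : ℤ) : Sˣ) : S) • M.map g := by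
    rw [← map_zpow]
    ext a b
    exact map_mul g _ _
  rw [hM, Matrix.smul_mulVec, ← Units.smul_def, zpow_sub, mul_comm, mul_smul, ← hx, inv_smul_smul]

variable [Algebra F R] [IsScalarTower F K R]

open Polynomial LaurentPolynomial in
lemma map_invert_toLaurent_eq {a b : Fin n → R} (ha : IsUnimodular (pencil b a)) {d : ℕ}
    {φ : assocSheaf (powerPresheaf e i) ⟶ assocSheaf (powerPresheaf e (i + d))}
    {P Q : Matrix (MultiIndex n (i + d)) (MultiIndex n i) R[X]}
    (hP : IsMatrixAt e θ φ (pencil a b) P) (hQ : IsMatrixAt e θ φ (pencil b a) Q) (x y) :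
    invert (toLaurent (Q x y)) = T d * toLaurent (P x y) := by
  let f₁ : R[X] →ₐ[K] R[T;T⁻¹] := toLaurentAlg.restrictScalars K
  let f₂ : R[X] →ₐ[K] R[T;T⁻¹] := (LaurentPolynomial.invert.toAlgHom.restrictScalars K).comp f₁
  let t : R[T;T⁻¹]ˣ := ⟨T (-1), T 1, by rw [← T_add]; simp, by rw [← T_add]; simp⟩
  have hglue : f₂ ∘ pencil b a = (t : R[T;T⁻¹]) • (f₁ ∘ pencil a b) :=
    funext (invert_toLaurent_pencil a b)
  have htd : ((t ^ (i - (i + d : ℕ) : ℤ) : R[T;T⁻¹]ˣ) : R[T;T⁻¹]) = T d := by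
    have : t ^ (i - (i + d : ℕ) : ℤ) = t⁻¹ ^ d := by simp
    rw [this, Units.val_pow_eq_pow_val]
    exact (T_pow 1 d).trans (by rw [mul_one])
  have hPQ := (hP.map f₁).smul t
  rw [← hglue] at hPQ
  have hentry := congrFun₂ ((hQ.map f₂).unique (ha.map f₂) hPQ) x y
  rw [htd] at hentry
  exact hentry

open Polynomial in
-- A morphism restricts to a section of a bundle of copies of `O(i - j)` on the line through `a, b`.
theorem exists_isMatrixAt_line (e : points X ≅ functor F A n)
    (θ : K ⊗[F] A ≃ₐ[K] Matrix (Fin n) (Fin n) K) (hij : i ≤ j)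
    (φ : assocSheaf (powerPresheaf e i) ⟶ assocSheaf (powerPresheaf e j)) {a b c d : Fin n → R}
    (hca : c ⬝ᵥ a = 1) (hcb : c ⬝ᵥ b = 0) (hda : d ⬝ᵥ a = 0) (hdb : d ⬝ᵥ b = 1) :
    ∃ M, (i < j → M = 0) ∧ (∀ r : R, IsMatrixAt e θ φ (a + r • b) M) ∧ IsMatrixAt e θ φ b M := by
  obtain ⟨m, rfl⟩ := Nat.exists_eq_add_of_le hij
  have hba : IsUnimodular (pencil b a) := isUnimodular_pencil hdb hda
  obtain ⟨P, hP⟩ := exists_isMatrixAt e θ (isUnimodular_pencil hca hcb) φ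
  obtain ⟨Q, hQ⟩ := exists_isMatrixAt e θ hba φ
  choose M hPM hQM hM0 using fun x y =>
    exists_eq_C_of_invert_toLaurent_eq_T_mul (map_invert_toLaurent_eq hba hP hQ x y)
  have eval_map (r : R) {v : Fin n → R[X]} {N} (h : IsMatrixAt e θ φ v N)
      (hN : ∀ x y, N x y = C (M x y)) :
      IsMatrixAt e θ φ (fun x => (v x).eval r) (Matrix.of M) := by
    have hr := h.map ((aeval r).restrictScalars K)
    have hv : ((aeval r).restrictScalars K : R[X] →ₐ[K] R) ∘ v = fun x => (v x).eval r :=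
      funext fun x => coe_aeval_eq_eval r ▸ rfl
    have hNM : N.map ((aeval r).restrictScalars K : R[X] →ₐ[K] R) = Matrix.of M := by
      ext x y
      simp [hN]
    rwa [hv, hNM] at hr
  refine ⟨Matrix.of M, fun hlt => Matrix.ext fun x y => hM0 x y (by omega), fun r => ?_, ?_⟩
  · simpa only [eval_pencil] using eval_map r hP hPM
  · simpa only [eval_pencil, zero_smul, add_zero] using eval_map 0 hQ hQM

namespace IsMatrixAt

lemma add_single (hij : i ≤ j) (h : IsMatrixAt e θ φ v M) {k l : Fin n} (hkl : k ≠ l)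
    (hv : v k = 1) (r : R) : IsMatrixAt e θ φ (v + Pi.single l r) M := by
  obtain ⟨N, -, hN, -⟩ := exists_isMatrixAt_line e θ hij φ (a := v) (b := Pi.single l 1)
    (c := Pi.single k 1) (d := Pi.single l 1 - v l • Pi.single k 1)
    (by simp [hv]) (by simp [hkl]) (by simp [sub_dotProduct, hv])
    (by simp [hkl])
  have h0 : IsMatrixAt e θ φ v N := by simpa using hN 0
  obtain rfl : N = M := h0.unique ⟨Pi.single k 1, by simp [hv]⟩ h
  simpa [← Pi.single_smul] using hN r

lemma of_single (hij : i ≤ j) {k : Fin n} (hM : IsMatrixAt e θ φ (Pi.single k (1 : R)) M)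
    (hv : v k = 1) : IsMatrixAt e θ φ v M := by
  classical
  have key (s : Finset (Fin n)) (hk : k ∉ s) :
      IsMatrixAt e θ φ (Pi.single k 1 + ∑ l ∈ s, Pi.single l (v l)) M := by
    induction s using Finset.induction_on with
    | empty => simpa using hM
    | insert l s hl ih =>
      rw [Finset.mem_insert, not_or] at hk
      rw [Finset.sum_insert hl, add_comm (Pi.single l _), ← add_assoc]
      refine (ih hk.2).add_single hij hk.1 ?_ (v l)
      rw [Pi.add_apply, Pi.single_eq_same, Finset.sum_apply, Finset.sum_eq_zero, add_zero]
      exact fun l hl => Pi.single_eq_of_ne (ne_of_mem_of_not_mem hl hk.2).symm _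
  have hsum := key (Finset.univ.erase k) (Finset.notMem_erase k _)
  rwa [← hv, Finset.add_sum_erase _ (fun l => Pi.single l (v l)) (Finset.mem_univ k),
    Finset.univ_sum_single] at hsum

end IsMatrixAt

lemma exists_isMatrixAt_single (e : points X ≅ functor F A n)
    (θ : K ⊗[F] A ≃ₐ[K] Matrix (Fin n) (Fin n) K) [NeZero n] (hij : i = j ∨ i < j ∧ 1 < n)
    (φ : assocSheaf (powerPresheaf e i) ⟶ assocSheaf (powerPresheaf e j)) :
    ∃ M : Matrix (MultiIndex n j) (MultiIndex n i) K, (i < j → M = 0) ∧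
      ∀ k, IsMatrixAt e θ φ (Pi.single k (1 : K)) M := by
  have h0 : IsUnimodular (Pi.single 0 1 : Fin n → K) := ⟨Pi.single 0 1, by simp⟩
  obtain ⟨M, hM⟩ := exists_isMatrixAt e θ h0 φ
  have hline {k : Fin n} (hk : k ≠ 0) :
      (i < j → M = 0) ∧ IsMatrixAt e θ φ (Pi.single k (1 : K)) M := by
    obtain ⟨N, hN0, hN, hN'⟩ := exists_isMatrixAt_line e θ (by omega : i ≤ j) φ
      (a := (Pi.single k 1 : Fin n → K)) (b := Pi.single 0 1) (c := Pi.single k 1)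
      (d := Pi.single 0 1) (by simp) (by simp [hk]) (by simp [hk.symm]) (by simp)
    obtain rfl : M = N := hM.unique h0 hN'
    exact ⟨hN0, by simpa using hN 0⟩
  refine ⟨M, fun hlt => ?_, fun k => ?_⟩
  · have hn : 1 < n := by omega
    exact (hline (k := ⟨1, hn⟩) (by simp [Fin.ext_iff])).1 hlt
  · rcases eq_or_ne k 0 with rfl | hk
    exacts [hM, (hline hk).2]

/-- `M` is the matrix of the morphism `φ : I^{⊗ i} → I^{⊗ j}` at every vector that has an invertible
entry, over every `K`-algebra; these vectors suffice to determine `φ`, because a unimodular vector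
over a local ring is of this form. -/
def IsConstantMatrix (e : points X ≅ functor F A n) (θ : K ⊗[F] A ≃ₐ[K] Matrix (Fin n) (Fin n) K)
    (φ : assocSheaf (powerPresheaf e i) ⟶ assocSheaf (powerPresheaf e j))
    (M : Matrix (MultiIndex n j) (MultiIndex n i) K) : Prop :=
  ∀ (R : Type u) [CommRing R] [Algebra F R] [Algebra K R] [IsScalarTower F K R]
    (v : Fin n → R) (k : Fin n), IsUnit (v k) → IsMatrixAt e θ φ v (M.map (algebraMap K R))

theorem exists_isConstantMatrix (e : points X ≅ functor F A n)
    (θ : K ⊗[F] A ≃ₐ[K] Matrix (Fin n) (Fin n) K) [NeZero n] (hij : i = j ∨ i < j ∧ 1 < n)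
    (φ : assocSheaf (powerPresheaf e i) ⟶ assocSheaf (powerPresheaf e j)) :
    ∃ M, (i < j → M = 0) ∧ IsConstantMatrix e θ φ M := by
  obtain ⟨M, hzero, hM⟩ := exists_isMatrixAt_single e θ hij φ
  refine ⟨M, hzero, fun R _ _ _ _ v k ⟨r, hr⟩ => ?_⟩
  have hk := (hM k).map (Algebra.ofId K R)
  have hsingle : Algebra.ofId K R ∘ (Pi.single k 1 : Fin n → K) = Pi.single k 1 := by
    ext x
    by_cases hx : x = k <;> simp [hx]
  rw [hsingle] at hk
  have hv := (IsMatrixAt.of_single (by omega) hk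
    (v := ((r⁻¹ : Rˣ) : R) • v) (by simp [← hr])).smul r
  rw [smul_smul, Units.mul_inv, one_smul] at hv
  convert hv using 1
  rcases hij with rfl | h
  · rw [sub_self, zpow_zero, Units.val_one, one_smul]
    rfl
  · rw [hzero h.1]
    ext
    simp

end ConstantMatrices

section LocalVanishing

attribute [local instance] Algebra.TensorProduct.rightAlgebra in
lemma eq_zero_of_forall_isLocalRing {F P ι : Type*} {K B : Type u} [CommRing F] [CommRing K]
    [Algebra F K] [CommRing B] [Algebra F B] [AddCommGroup P] [Module B P] (b : Module.Basis ι F K)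
    {y : ι →₀ P}
    (h : ∀ (R : Type u) [CommRing R] [Algebra F R] [Algebra K R] [IsScalarTower F K R]
      [Algebra B R] [IsScalarTower F B R] [IsLocalRing R],
      y.sum (fun m p => algebraMap K R (b m) • (1 : R) ⊗ₜ[B] p) = 0) :
    y = 0 := by
  let S := B ⊗[F] K
  refine TensorProduct.sum_tmul_basis_left_eq_zero (Algebra.TensorProduct.basis B b) y ?_
  refine Module.eq_zero_of_localization_maximal (R := S)
    (fun p _ => Localization.AtPrime p ⊗[B] P)
    (fun p _ => TensorProduct.AlgebraTensorModule.rTensor B P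
      (Algebra.linearMap S (Localization.AtPrime p))) _ fun p _ => ?_
  let R := Localization.AtPrime p
  have : IsScalarTower F K R := IsScalarTower.of_algebraMap_eq fun x => by
    rw [IsScalarTower.algebraMap_apply F S R, IsScalarTower.algebraMap_apply K S R,
      IsScalarTower.algebraMap_apply F K S]
  have : IsScalarTower F B R := IsScalarTower.of_algebraMap_eq fun x => by
    rw [IsScalarTower.algebraMap_apply F S R, IsScalarTower.algebraMap_apply B S R,
      IsScalarTower.algebraMap_apply F B S]
  rw [← h R, map_finsuppSum]
  refine Finsupp.sum_congr fun m _ => ?_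
  rw [Algebra.TensorProduct.basis_apply, TensorProduct.smul_tmul', smul_eq_mul, mul_one]
  rfl

end LocalVanishing

section Morphisms

variable {F : Type u} [Field F] {X : Over (Spec (.of F))} {A : Type u} [Ring A] [Algebra F A]
  [FiniteDimensional F A] {n : ℕ} [NeZero n] (e : points X ≅ functor F A n)
  {K : Type u} [Field K] [Algebra F K] (θ : K ⊗[F] A ≃ₐ[K] Matrix (Fin n) (Fin n) K)
  {i j : ℕ}

theorem finsupp_hom_eq_zero {ι : Type u} (b : Module.Basis ι F K)
    (φ : ι →₀ (assocSheaf (powerPresheaf e i) ⟶ assocSheaf (powerPresheaf e j)))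
    (h : ∀ (R : Type u) [CommRing R] [Algebra F R] [Algebra K R] [IsScalarTower F K R]
      [IsLocalRing R] (V : X.left.Opens) (hV : IsAffineOpen V) (u : Γ(X.left, V) →ₐ[F] R)
      (v c : Fin n → R) (hc : c ⬝ᵥ v = 1),
      (idealOfAffine e hV).map u = splitPoint θ v ⟨c, hc⟩ → ∀ x,
      φ.sum (fun m f => algebraMap K R (b m) • coord e θ u c j (act e f hV x)) = 0) :
    φ = 0 := by
  ext1 m
  refine (isLocalizing_powerPresheaf e j).eq_zero_of_affineMap _ fun V hV x => ?_
  let ev : (assocSheaf (powerPresheaf e i) ⟶ assocSheaf (powerPresheaf e j)) →+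
      (powerPresheaf e j).obj (op V) :=
    AddMonoidHom.mk' (fun f => act e f hV x) fun f g => IsLocalizing.affineMap_add _ f g hV x
  suffices φ.mapRange ev (map_zero ev) = 0 from DFunLike.congr_fun this m
  refine eq_zero_of_forall_isLocalRing (B := Γ(X.left, V)) b fun R _ _ _ _ _ _ _ => ?_
  let u := IsScalarTower.toAlgHom F Γ(X.left, V) R
  obtain ⟨v, ⟨c, hc⟩, hJ⟩ := exists_eq_splitPoint θ ((idealOfAffine e hV).map u)
  obtain ⟨l, hl, -⟩ := isSemilinearBaseChange_coord e θ hV u hc hJ j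
    (R ⊗[Γ(X.left, V)] (powerPresheaf e j).obj (op V)) (IsSemilinearBaseChange.oneTmul R _)
  have hzero := congrArg l (h R V hV u v c hc hJ x)
  rw [map_finsuppSum, map_zero] at hzero
  rw [Finsupp.sum_mapRange_index (fun m => by rw [TensorProduct.tmul_zero, smul_zero]), ← hzero]
  refine Finsupp.sum_congr fun m _ => ?_
  rw [map_smul, hl]
  rfl

end Morphisms

section KroneckerProducts

open scoped Kronecker

variable {ι κ R : Type*} [CommSemiring R]

lemma kronecker_map {ι' κ' S : Type*} [CommSemiring S] (f : R →+* S) (M : Matrix ι ι' R)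
    (N : Matrix κ κ' R) : (M ⊗ₖ N).map f = M.map f ⊗ₖ N.map f :=
  Matrix.ext fun _ _ => map_mul f _ _

lemma kronecker_mulVec_mul {ι' κ' : Type*} [Fintype ι'] [Fintype κ'] (M : Matrix ι ι' R)
    (N : Matrix κ κ' R) (x : ι' → R) (y : κ' → R) :
    (M ⊗ₖ N).mulVec (fun p => x p.1 * y p.2) = fun p => M.mulVec x p.1 * N.mulVec y p.2 := by
  ext p
  simp only [Matrix.mulVec, dotProduct, Matrix.kroneckerMap_apply]
  rw [Fintype.sum_prod_type, Finset.sum_mul_sum]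
  exact Finset.sum_congr rfl fun q _ => Finset.sum_congr rfl fun q' _ => mul_mul_mul_comm ..

lemma map₂_kroneckerBilinear_top [Finite ι] [Finite κ] :
    Submodule.map₂ (Matrix.kroneckerBilinear (R := R) :
      Matrix ι ι R →ₗ[R] Matrix κ κ R →ₗ[R] Matrix (ι × κ) (ι × κ) R) ⊤ ⊤ = ⊤ := by
  classical
  have := Fintype.ofFinite ι
  have := Fintype.ofFinite κ
  rw [eq_top_iff]
  intro M _
  rw [Matrix.matrix_eq_sum_single M]
  refine sum_mem fun p _ => sum_mem fun q _ => ?_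
  rw [← mul_one (M p q), ← Matrix.single_kronecker_single]
  exact Submodule.apply_mem_map₂ _ trivial trivial

end KroneckerProducts

section Action

variable {F : Type u} [Field F] {X : Over (Spec (.of F))} {A : Type u} [Ring A] [Algebra F A]
  {n : ℕ} (e : points X ≅ functor F A n)

lemma resTensor_mul_tmul {U V : X.left.Opens} (h : V ≤ U) (x : Γ(X.left, U) ⊗[F] A) (a : A) :
    resTensor X A h (x * (1 ⊗ₜ a)) = resTensor X A h x * (1 ⊗ₜ a) := by
  refine (extendTensor_mul (res X h) x (1 ⊗ₜ a)).trans ?_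
  rw [extendTensor_tmul, map_one]
  rfl

/-- Right multiplication by an element of `A` on sections of the tautological sheaf. -/
noncomputable def mulRightSections (a : A) (U : X.left.Opens) :
    tautologicalSections e U →ₗ[Γ(X.left, U)] tautologicalSections e U where
  toFun x := ⟨x.1 * (1 ⊗ₜ a), fun V hV h => by
    rw [resTensor_mul_tmul]
    exact (idealOfAffine e hV).mul_mem _ (x.2 V hV h) _⟩
  map_add' x y := Subtype.ext (add_mul x.1 y.1 _)
  map_smul' r x := Subtype.ext (smul_mul_assoc r x.1 _)

/-- Right multiplication by an element of `A` on the tautological sheaf. -/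
noncomputable def mulRightHom (a : A) : (tautologicalSubmodule e).toPresheafOfModules ⟶
    (tautologicalSubmodule e).toPresheafOfModules :=
  PresheafOfModules.homMk
    { app := fun U => AddCommGrpCat.ofHom (mulRightSections e a U.unop).toAddMonoidHom
      naturality := fun U V f => by
        ext x
        exact Subtype.ext (resTensor_mul_tmul (leOfHom f.unop) _ a).symm }
    fun U r x => map_smul (mulRightSections e a U.unop) r x

/-- Multiplication by a scalar on the structure sheaf. -/
noncomputable def scalarHom (r : F) : powerPresheaf e 0 ⟶ powerPresheaf e 0 :=
  PresheafOfModules.homMk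
    { app := fun U => AddCommGrpCat.ofHom
        (LinearMap.mulLeft Γ(X.left, U.unop) (algebraMap F Γ(X.left, U.unop) r)).toAddMonoidHom
      naturality := fun U V f => by
        ext x
        refine Eq.symm ((map_mul (X.left.presheaf.map f).hom _ _).trans ?_)
        exact congrArg (· * _) (algebraMap_res X (leOfHom f.unop) r) }
    fun U s x => mul_left_comm (algebraMap F Γ(X.left, U.unop) r) (s : Γ(X.left, U.unop)) x

variable (F A) in
/-- Data for an endomorphism of `I^{⊗ k}`: a scalar and elements of `A` for each of the factors. -/
def ActIndex : ℕ → Type u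
  | 0 => F
  | k + 1 => ActIndex k × A

open MonoidalCategory in
/-- The endomorphism of `I^{⊗ k}` given by right multiplications on the factors, and for `k = 0` by
a scalar. -/
noncomputable def actHom : ∀ k, ActIndex F A k → (powerPresheaf e k ⟶ powerPresheaf e k)
  | 0, r => scalarHom e r
  | k + 1, g => actHom k g.1 ⊗ₘ mulRightHom e g.2

lemma actHom_tmulSec {V : X.left.Opens} {k : ℕ} (g : ActIndex F A (k + 1))
    (s : (powerPresheaf e k).obj (op V))
    (x : (tautologicalSubmodule e).toPresheafOfModules.obj (op V)) :
    (actHom e (k + 1) g).app (op V) (tmulSec e s x) =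
      tmulSec e ((actHom e k g.1).app (op V) s) ((mulRightHom e g.2).app (op V) x) := rfl

variable {K : Type u} [Field K] [Algebra F K] (θ : K ⊗[F] A ≃ₐ[K] Matrix (Fin n) (Fin n) K)
  {R : Type u} [CommRing R] [Algebra F R] [Algebra K R] [IsScalarTower F K R]

open scoped Kronecker in
/-- The matrix of the endomorphism `actHom`; the transposes are there because right multiplication
acts on the coordinates of `I`, which are row vectors. -/
noncomputable def actMatrix : ∀ k, ActIndex F A k → Matrix (MultiIndex n k) (MultiIndex n k) K
  | 0, r => algebraMap F (Matrix Unit Unit K) r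
  | k + 1, g => (actMatrix k g.1) ⊗ₖ (θ (1 ⊗ₜ g.2)).transpose

lemma coordOne_mulRightHom {V : X.left.Opens} (u : Γ(X.left, V) →ₐ[F] R) (c : Fin n → R) (a : A)
    (x : (tautologicalSubmodule e).toPresheafOfModules.obj (op V)) :
    coordOne e θ u c ((mulRightHom e a).app (op V) x) =
      ((θ (1 ⊗ₜ a)).transpose.map (algebraMap K R)).mulVec (coordOne e θ u c x) := by
  obtain ⟨x, hx⟩ : tautologicalSections e V := x
  change splitCoord θ c (extendTensor A u (x * (1 ⊗ₜ a))) =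
    Matrix.mulVec _ (splitCoord θ c (extendTensor A u x))
  rw [extendTensor_mul, extendTensor_tmul, map_one, splitCoord_apply, splitCoord_apply, map_mul,
    splitEquiv_tmul, one_smul, ← Matrix.vecMul_vecMul, Matrix.transpose_map,
    Matrix.mulVec_transpose]

open scoped Kronecker in
lemma actMatrix_succ {k : ℕ} (g : ActIndex F A (k + 1)) :
    actMatrix θ (k + 1) g = actMatrix θ k g.1 ⊗ₖ (θ (1 ⊗ₜ g.2)).transpose := rfl

lemma coord_scalarHom {V : X.left.Opens} (u : Γ(X.left, V) →ₐ[F] R) (c : Fin n → R) (r : F)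
    (x : (powerPresheaf e 0).obj (op V)) :
    coord e θ u c 0 ((scalarHom e r).app (op V) x) = algebraMap F R r • coord e θ u c 0 x :=
  funext fun _ => (map_mul u _ _).trans (congrArg (· * _) (u.commutes r))

lemma actMatrix_zero_map_mulVec (r : F) (y : MultiIndex n 0 → R) :
    ((actMatrix (A := A) θ 0 r).map (algebraMap K R)).mulVec y = algebraMap F R r • y := by
  have hdiag : (actMatrix (A := A) θ 0 r).map (algebraMap K R) =
      Matrix.diagonal fun _ : Unit => algebraMap F R r := by
    refine (Matrix.diagonal_map (map_zero _)).trans (congrArg Matrix.diagonal (funext fun _ => ?_))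
    exact (IsScalarTower.algebraMap_apply F K R r).symm
  rw [hdiag]
  exact funext fun q => Matrix.mulVec_diagonal _ y q

lemma coord_actHom {V : X.left.Opens} (u : Γ(X.left, V) →ₐ[F] R) (c : Fin n → R) :
    ∀ (k : ℕ) (g : ActIndex F A k) (x : (powerPresheaf e k).obj (op V)),
    coord e θ u c k ((actHom e k g).app (op V) x) =
      ((actMatrix θ k g).map (algebraMap K R)).mulVec (coord e θ u c k x)
  | 0, (r : F), x => (coord_scalarHom e θ u c r x).trans (actMatrix_zero_map_mulVec θ r _).symm
  | k + 1, g, x => by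
    induction x using power_induction with
    | h0 => rw [map_zero, map_zero, Matrix.mulVec_zero]
    | hadd x y hx hy => rw [map_add, map_add, map_add, hx, hy, Matrix.mulVec_add]
    | hmul s x =>
      rw [actHom_tmulSec, actMatrix_succ, funext (coord_tmulSec e θ u c _ _),
        funext (coord_tmulSec e θ u c s x), coord_actHom u c k, coordOne_mulRightHom]
      refine (kronecker_mulVec_mul _ _ _ _).symm.trans (congrArg (Matrix.mulVec · _) ?_)
      exact (kronecker_map _ _ _).symm

variable (F A) in
lemma exists_actMatrix_eq_algebraMap (r : F) : ∀ k, ∃ g : ActIndex F A k,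
    actMatrix θ k g = algebraMap F (Matrix (MultiIndex n k) (MultiIndex n k) K) r
  | 0 => ⟨r, rfl⟩
  | k + 1 => by
    obtain ⟨g, hg⟩ := exists_actMatrix_eq_algebraMap r k
    refine ⟨(g, 1), ?_⟩
    refine (actMatrix_succ θ (k := k) (g, 1)).trans ?_
    rw [hg, ← Algebra.TensorProduct.one_def, map_one, Matrix.transpose_one,
      Algebra.algebraMap_eq_smul_one, Matrix.smul_kronecker, Matrix.one_kronecker_one]
    exact (Algebra.algebraMap_eq_smul_one r).symm

lemma span_range_transpose_tmul :
    Submodule.span K (Set.range fun a : A => (θ (1 ⊗ₜ[F] a)).transpose) = ⊤ := by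
  have hspan : Submodule.span K (Set.range fun a : A => (1 : K) ⊗ₜ[F] a) = ⊤ := by
    rw [← Submodule.baseChange_top, Submodule.baseChange_eq_span, Submodule.map_top,
      LinearMap.coe_range]
    rfl
  let l : K ⊗[F] A ≃ₗ[K] Matrix (Fin n) (Fin n) K :=
    θ.toLinearEquiv.trans (Matrix.transposeLinearEquiv (Fin n) (Fin n) K K)
  have hrange : (Set.range fun a : A => (θ (1 ⊗ₜ[F] a)).transpose) =
      l.toLinearMap '' Set.range fun a : A => (1 : K) ⊗ₜ[F] a := by
    rw [← Set.range_comp]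
    rfl
  rw [hrange, Submodule.span_image, hspan, Submodule.map_top, LinearEquiv.range]

lemma span_range_actMatrix : ∀ k, Submodule.span K (Set.range (actMatrix (F := F) (A := A) θ k)) = ⊤
  | 0 => by
    rw [eq_top_iff]
    intro M _
    have hM : M = M () () • actMatrix (F := F) (A := A) θ 0 (1 : F) := by
      have hone : actMatrix (A := A) θ 0 (1 : F) = (1 : Matrix Unit Unit K) := map_one _
      rw [hone]
      exact Matrix.ext fun _ _ => (mul_one _).symm
    rw [hM]
    exact Submodule.smul_mem _ _ (Submodule.subset_span ⟨_, rfl⟩)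
  | k + 1 => by
    have h := Submodule.map₂_span_span K (Matrix.kroneckerBilinear (R := K) :
      Matrix (MultiIndex n k) (MultiIndex n k) K →ₗ[K] Matrix (Fin n) (Fin n) K →ₗ[K] _)
      (Set.range (actMatrix (F := F) (A := A) θ k))
      (Set.range fun a : A => (θ (1 ⊗ₜ[F] a)).transpose)
    rw [span_range_actMatrix k, span_range_transpose_tmul, map₂_kroneckerBilinear_top] at h
    rw [eq_top_iff]
    refine h.le.trans (Submodule.span_mono ?_)
    rintro _ ⟨_, ⟨g, rfl⟩, _, ⟨a, rfl⟩, rfl⟩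
    exact ⟨(g, a), rfl⟩

end Action

section Endomorphisms

variable {F : Type u} [Field F] {X : Over (Spec (.of F))} {A : Type u} [Ring A] [Algebra F A]
  [FiniteDimensional F A] {n : ℕ} {e : points X ≅ functor F A n}
  {K : Type u} [Field K] [Algebra F K]
  {θ : K ⊗[F] A ≃ₐ[K] Matrix (Fin n) (Fin n) K} {i j : ℕ}

lemma IsConstantMatrix.isMatrixAt_single [NeZero n] {M : Matrix (MultiIndex n j) (MultiIndex n i) K}
    {φ : assocSheaf (powerPresheaf e i) ⟶ assocSheaf (powerPresheaf e j)}
    (h : IsConstantMatrix e θ φ M) : IsMatrixAt e θ φ (Pi.single 0 (1 : K)) M :=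
  h K (Pi.single 0 1) 0 (by simp)

variable [NeZero n]

lemma finsupp_eq_zero_of_isConstantMatrix {ι : Type u} (b : Module.Basis ι F K)
    {φ : ι →₀ (assocSheaf (powerPresheaf e i) ⟶ assocSheaf (powerPresheaf e j))}
    {M : ι → Matrix (MultiIndex n j) (MultiIndex n i) K}
    (hM : ∀ m ∈ φ.support, IsConstantMatrix e θ (φ m) (M m))
    (h : ∑ m ∈ φ.support, b m • M m = 0) : φ = 0 := by
  refine finsupp_hom_eq_zero e θ b φ fun R _ _ _ _ _ V hV u v c hc hJ x => ?_
  obtain ⟨k, hk⟩ := IsUnimodular.exists_isUnit ⟨c, hc⟩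
  have hact (m : ι) (hm : m ∈ φ.support) : coord e θ u c j (act e (φ m) hV x) =
      ((M m).map (algebraMap K R)).mulVec (coord e θ u c i x) :=
    hM m hm R v k hk R (AlgHom.id K R) V hV u c hc hJ x
  have hsum : ∑ m ∈ φ.support, algebraMap K R (b m) • (M m).map (algebraMap K R) = 0 := by
    rw [← Matrix.map_zero (algebraMap K R) (map_zero _), ← h]
    ext p q
    simp [Matrix.sum_apply, Algebra.smul_def]
  calc φ.sum (fun m f => algebraMap K R (b m) • coord e θ u c j (act e f hV x))
      = ∑ m ∈ φ.support, (algebraMap K R (b m) • (M m).map (algebraMap K R)).mulVec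
          (coord e θ u c i x) := Finset.sum_congr rfl fun m hm => by
        beta_reduce
        rw [hact m hm, Matrix.smul_mulVec]
    _ = 0 := by rw [← Matrix.sum_mulVec, hsum, Matrix.zero_mulVec]

lemma IsConstantMatrix.eq_zero
    {φ : assocSheaf (powerPresheaf e i) ⟶ assocSheaf (powerPresheaf e j)}
    (h : IsConstantMatrix e θ φ 0) : φ = 0 := by
  let b := Module.Basis.ofVectorSpace F K
  obtain ⟨m⟩ := b.index_nonempty
  refine Finsupp.single_eq_zero.mp (finsupp_eq_zero_of_isConstantMatrix (θ := θ) b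
    (φ := .single m φ) (M := fun _ => 0) (fun m' hm' => ?_) (by simp))
  obtain rfl := Finset.mem_singleton.mp (Finsupp.support_single_subset hm')
  rwa [Finsupp.single_eq_same]

variable (e θ)

include θ in
theorem hom_eq_zero_of_lt (hij : i < j) (hn : 1 < n)
    (φ : assocSheaf (powerPresheaf e i) ⟶ assocSheaf (powerPresheaf e j)) : φ = 0 := by
  obtain ⟨M, hzero, hM⟩ := exists_isConstantMatrix e θ (Or.inr ⟨hij, hn⟩) φ
  rw [hzero hij] at hM
  exact hM.eq_zero

/-- The matrix of an endomorphism of `I^{⊗ i}`. -/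
noncomputable def matrixOf (φ : End (assocSheaf (powerPresheaf e i))) :
    Matrix (MultiIndex n i) (MultiIndex n i) K :=
  (exists_isConstantMatrix e θ (Or.inl rfl) φ).choose

lemma isConstantMatrix_matrixOf (φ : End (assocSheaf (powerPresheaf e i))) :
    IsConstantMatrix e θ φ (matrixOf e θ φ) :=
  (exists_isConstantMatrix e θ (Or.inl rfl) φ).choose_spec.2

variable {e θ} in
lemma matrixOf_eq {φ : End (assocSheaf (powerPresheaf e i))}
    {M : Matrix (MultiIndex n i) (MultiIndex n i) K}
    (h : IsMatrixAt e θ φ (Pi.single 0 (1 : K)) M) : matrixOf e θ φ = M :=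
  (isConstantMatrix_matrixOf e θ φ).isMatrixAt_single.unique ⟨Pi.single 0 1, by simp⟩ h

/-- The representation of the endomorphism ring of `I^{⊗ i}` by matrices over `K`. -/
noncomputable def matrixHom (i : ℕ) :
    End (assocSheaf (powerPresheaf e i)) →+* Matrix (MultiIndex n i) (MultiIndex n i) K :=
  RingHom.mk' ⟨⟨matrixOf e θ, matrixOf_eq (IsMatrixAt.id _)⟩, fun φ ψ => matrixOf_eq <|
      (isConstantMatrix_matrixOf e θ ψ).isMatrixAt_single.comp
        (isConstantMatrix_matrixOf e θ φ).isMatrixAt_single⟩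
    fun φ ψ => matrixOf_eq <| (isConstantMatrix_matrixOf e θ φ).isMatrixAt_single.add
      (isConstantMatrix_matrixOf e θ ψ).isMatrixAt_single

lemma matrixHom_assocMap_actHom (g : ActIndex F A i) :
    matrixHom e θ i (assocMap (actHom e i g)) = actMatrix θ i g := by
  refine matrixOf_eq fun S _ _ _ _ f V hV u c _ _ x => ?_
  refine (congrArg (coord e θ u c i) (IsLocalizing.affineMap_assocMap _ _ _ _)).trans ?_
  rw [coord_actHom]
  congr 2
  ext
  exact (f.commutes _).symm

lemma finsupp_eq_zero_of_sum_matrixHom {ι : Type u} (b : Module.Basis ι F K)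
    {φ : ι →₀ End (assocSheaf (powerPresheaf e i))}
    (h : φ.sum (fun m f => b m • matrixHom e θ i f) = 0) : φ = 0 :=
  finsupp_eq_zero_of_isConstantMatrix b (fun m _ => isConstantMatrix_matrixOf e θ (φ m)) h

lemma matrixHom_injective : Function.Injective (matrixHom e θ i) := by
  rw [injective_iff_map_eq_zero]
  intro φ hφ
  have hconst := isConstantMatrix_matrixOf e θ φ
  rw [show matrixOf e θ φ = 0 from hφ] at hconst
  exact hconst.eq_zero

/-- The endomorphism ring of `I^{⊗ i}`, as an `F`-algebra of matrices over `K`. -/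
noncomputable def endSubalgebra (i : ℕ) :
    Subalgebra F (Matrix (MultiIndex n i) (MultiIndex n i) K) where
  __ := (matrixHom e θ i).range.toSubsemiring
  algebraMap_mem' r := by
    obtain ⟨g, hg⟩ := exists_actMatrix_eq_algebraMap F A θ r i
    exact ⟨assocMap (actHom e i g), (matrixHom_assocMap_actHom e θ g).trans hg⟩

/-- The identification of the endomorphism ring of `I^{⊗ i}` with an algebra of matrices. -/
noncomputable def endEquiv (i : ℕ) :
    End (assocSheaf (powerPresheaf e i)) ≃+* endSubalgebra e θ i :=
  RingEquiv.ofBijective (matrixHom e θ i).rangeRestrict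
    ⟨fun _ _ h => matrixHom_injective e θ (congrArg Subtype.val h),
      (matrixHom e θ i).rangeRestrict_surjective⟩

lemma coe_endEquiv (φ : End (assocSheaf (powerPresheaf e i))) :
    (endEquiv e θ i φ : Matrix (MultiIndex n i) (MultiIndex n i) K) = matrixHom e θ i φ := rfl

lemma injective_liftBaseChange_endSubalgebra (i : ℕ) :
    Function.Injective ((endSubalgebra e θ i).val.toLinearMap.liftBaseChange K) := by
  let b := Module.Basis.ofVectorSpace F K
  refine injective_liftBaseChange_of_basis F b fun y hy => ?_
  have hφ : y.mapRange (endEquiv e θ i).symm (map_zero _) = 0 := by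
    refine finsupp_eq_zero_of_sum_matrixHom e θ b ?_
    rw [Finsupp.sum_mapRange_index (fun m => by rw [map_zero, smul_zero]), ← hy]
    refine Finsupp.sum_congr fun m _ => ?_
    rw [← coe_endEquiv, RingEquiv.apply_symm_apply]
    rfl
  exact Finsupp.mapRange_injective _ (map_zero _) (endEquiv e θ i).symm.injective
    (hφ.trans Finsupp.mapRange_zero.symm)

lemma surjective_liftBaseChange_endSubalgebra (i : ℕ) :
    Function.Surjective ((endSubalgebra e θ i).val.toLinearMap.liftBaseChange K) := by
  rw [← LinearMap.range_eq_top, LinearMap.range_liftBaseChange, eq_top_iff,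
    ← span_range_actMatrix (F := F) (A := A) θ i]
  refine Submodule.span_mono ?_
  rintro _ ⟨g, rfl⟩
  exact ⟨⟨actMatrix θ i g, assocMap (actHom e i g), matrixHom_assocMap_actHom e θ g⟩, rfl⟩

include θ in
theorem isSemisimpleRing_end (i : ℕ) : IsSemisimpleRing (End (assocSheaf (powerPresheaf e i))) :=
  have : IsSemisimpleRing (endSubalgebra e θ i) :=
    isSemisimpleRing_of_bijective_liftBaseChange (endSubalgebra e θ i).val
      ⟨injective_liftBaseChange_endSubalgebra e θ i, surjective_liftBaseChange_endSubalgebra e θ i⟩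
  (endEquiv e θ i).symm.isSemisimpleRing

end Endomorphisms

end SeveriBrauer

/-- Let `A` be a central simple algebra of degree `n` over a field `F`, `X` its Severi-Brauer variety
(the `F`-scheme representing the functor of right ideals of reduced dimension `1`), and `T` the
sheaf `𝒪 ⊕ I ⊕ ⋯ ⊕ I^{⊗ (n - 1)}` on `X`, `I` the tautological sheaf. Then the ring `End(T)` has
finite global dimension. -/
theorem mainTheorem7 (F : Type u) [Field F] (A : Type u) [Ring A] [Algebra F A]
    [FiniteDimensional F A] [Algebra.IsCentral F A] [IsSimpleRing A]
    (n : ℕ) (hn : Module.finrank F A = n ^ 2)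
    (X : Over (Spec (.of F))) (e : SeveriBrauer.points X ≅ SeveriBrauer.functor F A n) :
    globalDimension (End (SeveriBrauer.tiltingSheaf e)) < ⊤ := by
  have : NeZero n := ⟨by
    rintro rfl
    exact (Module.finrank_pos (R := F) (M := A)).ne' (hn.trans (zero_pow two_ne_zero))⟩
  obtain ⟨θ⟩ := exists_algEquiv_matrix_of_isAlgClosed F (AlgebraicClosure F) A hn
  have := Abelian.hasFiniteBiproducts (C := X.left.Modules)
  have (i : Fin n) : IsSemisimpleRing (End (SeveriBrauer.tautologicalPower e i)) :=
    SeveriBrauer.isSemisimpleRing_end e θ i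
  exact globalDimension_end_biproduct_lt_top
    (fun k : Fin n => SeveriBrauer.tautologicalPower e k)
    fun i j hij f => SeveriBrauer.hom_eq_zero_of_lt e θ hij (by omega) f
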